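/- **Setting.** Let $d\in\{2,3\}$ and let $\Omega\subset\mathbb R^d$ be a bounded polygonal (polyhedral) domain with $\Omega=\operatorname{int}\overline\Omega$, divided into two disjoint connected open subdomains $\Omega_1,\Omega_2$, with $\overline{\Omega_1}\subset\Omega$, by the Lipschitz interface $\Gamma=\partial\Omega_1\cap\partial\Omega_2$, i.e. $\Omega=\Omega_1\cup\Gamma\cup\Omega_2$ and near each of its points $\Gamma$ is the graph of a Lipschitz function, with $\Omega_1$ on one side and $\Omega_2$ on the other. Let $\mathbf n$ be the unit normal on $\Gamma$ pointing out of $\Omega_1$. Let $\alpha=\alpha_i>0$ be constant on $\Omega_i$ and let $\lambda>0$. Let $\mathcal T_h$ be a conforming simplicial triangulation of $\Omega$ with $h_T=\operatorname{diam}T$ and $h=\max_T h_T$. Fix constants $\sigma,\mu$. We call $\mathcal T_h$ admissible if * every $T\in\mathcal T_h$ contains a ball of some radius $r_T>0$ with $h_T\le\sigma r_T$ (shape regularity); * $h\le\mu h_T$ for every cut element, i.e. every $T\in\mathcal T_h$ with $T\cap\Gamma\ne\emptyset$ (quasi-uniformity near $\Gamma$); * no vertex lies on $\Gamma$, and $\Gamma\cap\partial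 T$ has $(d-1)$-dimensional measure zero for every $T$; * for every cut element $T$ and $i=1,2$, the part $T_i=T\cap\Omega_i$ has positive measure and $T$ has a vertex in $\Omega_i$. Let $\phi_j$ be the nodal piecewise linear basis functions of the internal vertices $\mathbf x_j$ (those in $\Omega$), and let $V_h=\operatorname{span}\{\phi_j\}$. For $l=1,2$ let $\mathcal J_{\Gamma,l}$ be the set of those $j$ for which $\Gamma\cap\operatorname{supp}\phi_j$ has positive $(d-1)$-dimensional measure and $\mathbf x_j\in\Omega_{3-l}$. With $H_\Gamma=0$ on $\Omega_1$ and $H_\Gamma=1$ on $\Omega_2$ put $$\phi_j^\Gamma=\phi_j\,|H_\Gamma-H_\Gamma(\mathbf x_j)|,\qquad \mathcal W_l=\operatorname{span}\{\phi_j^\Gamma : j\in\mathcal J_{\Gamma,l}\},\qquad V_h^\Gamma=V_h+\mathcal W_1+\mathcal W_2 .$$ Let $[u]=u_1-u_2$ be the jump of the one-sided traces across $\Gamma$, let $\{w\}=\kappa_1w_1+\kappa_2w_2$ with $\kappa_i=|T_i|/|T|$ on $\Gamma\cap T$, and let $$a_h(u,v)=\sum_{i=1}^2\int_{\Omega_i}\alpha_i\nabla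 u\cdot\nabla v\,dx-\int_\Gamma\{\alpha\nabla u\cdot\mathbf n\}[v]\,ds-\int_\Gamma\{\alpha\nabla v\cdot\mathbf n\}[u]\,ds+\lambda h^{-1}\int_\Gamma[u][v]\,ds .$$ With $(u,v)_0=\int_\Omega uv\,dx$, the Ritz operator $A_l:\mathcal W_l\to\mathcal W_l$ is defined by $(A_lu,v)_0=a_h(u,v)$ for all $u,v\in\mathcal W_l$. The Jacobi operator $B_l:\mathcal W_l\to\mathcal W_l$ is defined by $$(B_lu,v)_0=\sum_{j\in\mathcal J_{\Gamma,l}}a_jb_j\,a_h(\phi_j^\Gamma,\phi_j^\Gamma)\quad\text{for}\quad u=\sum_{j\in\mathcal J_{\Gamma,l}}a_j\phi_j^\Gamma,\quad v=\sum_{j\in\mathcal J_{\Gamma,l}}b_j\phi_j^\Gamma .$$ **Lemma 4.2.** There is a constant $c_\lambda>0$, depending only on $d,\Omega,\Omega_1,\Omega_2,\sigma,\mu$, such that the following holds for all $\alpha_1,\alpha_2>0$, all $\lambda>0$ and every family $\mathcal F$ of admissible triangulations. Suppose that $\lambda$ is sufficiently large, in the sense that $\lambda>c_\lambda\max\{\alpha_1,\alpha_2\}$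 or, more generally, that there are constants $c,C>0$ such that, for every triangulation in $\mathcal F$ and every $u\in V_h^\Gamma$, $$c\,|||u|||^2\le a_h(u,u)\le C\,|||u|||^2,\qquad |||u|||^2=\sum_{i=1}^2\|\nabla u\|_{L^2(\Omega_i)}^2+\lambda h^{-1}\|[u]\|_{L^2(\Gamma)}^2 .$$ Then there are constants $\gamma_l,\rho_l>0$ ($l=1,2$) such that for every triangulation in $\mathcal F$ (hence independently of $h$ and of how $\Gamma$ cuts the triangulation) and for $l=1,2$ the operators $A_l$ and $B_l$ exist, are unique, and satisfy $$\gamma_l\,(B_lu,u)_0\le(A_lu,u)_0\le\rho_l\,(B_lu,u)_0\qquad\text{for all }u\in\mathcal W_l .$$ -/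

import Mathlib

open MeasureTheory Set Topology Filter
open scoped BigOperators NNReal

noncomputable section

namespace NitscheXFEM

/-- `ν` is the outward unit normal of the set `D` at the point `x`: to first order at `x`, the set
`D` is the half space `{y | ⟪ν, y - x⟫ < 0}`. Such a `ν` is unique if it exists. -/
def IsOuterUnitNormal {d : ℕ} (D : Set (EuclideanSpace ℝ (Fin d)))
    (x ν : EuclideanSpace ℝ (Fin d)) : Prop :=
  ‖ν‖ = 1 ∧ ∀ ε : ℝ, 0 < ε → ∀ᶠ y in 𝓝 x,
    (y ∈ D → inner ℝ ν (y - x) ≤ ε * ‖y - x‖) ∧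
    (y ∉ D → -(ε * ‖y - x‖) ≤ inner ℝ ν (y - x))

open Classical in
/-- The outward unit normal field of `D` (with value `0` where there is no normal; on a Lipschitz
boundary this is a null set for the surface measure). -/
def outerNormal {d : ℕ} (D : Set (EuclideanSpace ℝ (Fin d))) (x : EuclideanSpace ℝ (Fin d)) :
    EuclideanSpace ℝ (Fin d) :=
  if h : ∃ ν, IsOuterUnitNormal D x ν then h.choose else 0

/-- A bounded domain `Ω` in `ℝᵈ`, divided into two connected subdomains `sub 0` and `sub 1` (the
`Ω₁` and `Ω₂` of the text) by a Lipschitz interface `Γ = ∂Ω₁ ∩ ∂Ω₂`, with `Ω₁` strictly inside `Ω`.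
That `Ω` is polygonal (polyhedral) is implied by the existence of a triangulation. -/
structure Geometry (d : ℕ) where
  Ω : Set (EuclideanSpace ℝ (Fin d))
  sub : Fin 2 → Set (EuclideanSpace ℝ (Fin d))
  isOpen_Ω : IsOpen Ω
  bounded_Ω : Bornology.IsBounded Ω
  connected_Ω : IsConnected Ω
  interior_closure_Ω : interior (closure Ω) = Ω
  isOpen_sub : ∀ i, IsOpen (sub i)
  connected_sub : ∀ i, IsConnected (sub i)
  disjoint_sub : Disjoint (sub 0) (sub 1)
  union_eq : Ω = sub 0 ∪ sub 1 ∪ (frontier (sub 0) ∩ frontier (sub 1))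
  closure_sub_zero : closure (sub 0) ⊆ Ω
  /-- Near each of its points, `Γ` is the graph (in a direction `e`) of a Lipschitz function of the
  remaining coordinates, with `Ω₁` on one side and `Ω₂` on the other. The function is written as a
  Lipschitz function on the whole space that is constant in direction `e`. -/
  lipschitz_interface : ∀ x ∈ frontier (sub 0) ∩ frontier (sub 1),
    ∃ (e : EuclideanSpace ℝ (Fin d)) (r : ℝ) (L : ℝ≥0) (ψ : EuclideanSpace ℝ (Fin d) → ℝ),
      ‖e‖ = 1 ∧ 0 < r ∧ LipschitzWith L ψ ∧ (∀ y, ∀ t : ℝ, ψ (y + t • e) = ψ y) ∧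
      ∀ y ∈ Metric.ball x r,
        (y ∈ sub 0 ↔ inner ℝ e y < ψ y) ∧ (y ∈ sub 1 ↔ ψ y < inner ℝ e y)

/-- The interface. -/
def Geometry.Γ {d : ℕ} (G : Geometry d) : Set (EuclideanSpace ℝ (Fin d)) :=
  frontier (G.sub 0) ∩ frontier (G.sub 1)

/-- The unit normal on `Γ` that points out of `Ω₁`. -/
def Geometry.n {d : ℕ} (G : Geometry d) : EuclideanSpace ℝ (Fin d) → EuclideanSpace ℝ (Fin d) :=
  outerNormal (G.sub 0)

/-- The surface measure: the `(d-1)`-dimensional Hausdorff measure with its Euclidean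
normalization. -/
def surf (d : ℕ) : Measure (EuclideanSpace ℝ (Fin d)) :=
  Measure.euclideanHausdorffMeasure (d - 1)

/-- The simplex with given vertices, as a closed set. -/
def simplex {d : ℕ} (T : Finset (EuclideanSpace ℝ (Fin d))) : Set (EuclideanSpace ℝ (Fin d)) :=
  convexHull ℝ (T : Set (EuclideanSpace ℝ (Fin d)))

/-- A conforming simplicial triangulation of `Ω`: finitely many nondegenerate `d`-simplices, given
by their vertex sets, which cover the closure of `Ω` and any two of which meet in a common face
(possibly empty). -/
structure Triangulation {d : ℕ} (Ω : Set (EuclideanSpace ℝ (Fin d))) where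
  elems : Finset (Finset (EuclideanSpace ℝ (Fin d)))
  card_eq : ∀ T ∈ elems, T.card = d + 1
  indep : ∀ T ∈ elems, AffineIndependent ℝ ((↑) : T → EuclideanSpace ℝ (Fin d))
  conforming : ∀ T ∈ elems, ∀ T' ∈ elems, simplex T ∩ simplex T' =
    convexHull ℝ ((T : Set (EuclideanSpace ℝ (Fin d))) ∩ (T' : Set (EuclideanSpace ℝ (Fin d))))
  cover : ⋃ T ∈ elems, simplex T = closure Ω

namespace Triangulation

section Mesh

variable {d : ℕ} {Ω : Set (EuclideanSpace ℝ (Fin d))} (𝒯 : Triangulation Ω)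

/-- The mesh size `h`, the largest diameter of an element. -/
def h : ℝ := ⨆ T : 𝒯.elems, Metric.diam (simplex (T : Finset (EuclideanSpace ℝ (Fin d))))

open Classical in
/-- The internal vertices of the triangulation. -/
def nodes : Finset (EuclideanSpace ℝ (Fin d)) :=
  (𝒯.elems.biUnion id).filter (fun p => p ∈ Ω)

/-- The nodal (hat) function of the vertex `p`: its value at a point `x` of an element `T` is the
barycentric coordinate `w p` of `x` in `T` that belongs to `p` (which is `0` if `p` is not a vertex
of `T`), and its value outside the triangulation is `sSup ∅ = 0`. As the triangulation is
conforming, the set below has exactly one element for `x` in the closure of `Ω`. -/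
def hat (p x : EuclideanSpace ℝ (Fin d)) : ℝ :=
  sSup {t : ℝ | ∃ T ∈ 𝒯.elems, ∃ w : EuclideanSpace ℝ (Fin d) → ℝ,
    (∀ q, 0 ≤ w q) ∧ (∀ q, q ∉ T → w q = 0) ∧ ∑ q ∈ T, w q = 1 ∧ ∑ q ∈ T, w q • q = x ∧ t = w p}

/-- The continuous piecewise linear functions with zero boundary values. -/
def V : Submodule ℝ (EuclideanSpace ℝ (Fin d) → ℝ) :=
  Submodule.span ℝ (𝒯.hat '' (𝒯.nodes : Set (EuclideanSpace ℝ (Fin d))))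

end Mesh

section Cut

variable {d : ℕ} {G : Geometry d} (𝒯 : Triangulation G.Ω)

/-- The assumptions on a triangulation, with a shape regularity constant `σ` and a quasi-uniformity
constant `μ`. -/
structure Admissible (σ μ : ℝ) : Prop where
  /-- Each element contains a ball whose radius is comparable with the diameter of the element. -/
  shape_regular : ∀ T ∈ 𝒯.elems, ∃ (c : EuclideanSpace ℝ (Fin d)) (r : ℝ), 0 < r ∧
    Metric.closedBall c r ⊆ simplex T ∧ Metric.diam (simplex T) ≤ σ * r
  /-- The cut elements are quasi-uniform. -/
  quasi_uniform : ∀ T ∈ 𝒯.elems, (simplex T ∩ G.Γ).Nonempty →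
    𝒯.h ≤ μ * Metric.diam (simplex T)
  /-- No vertex lies on the interface. -/
  vertex_off : ∀ T ∈ 𝒯.elems, ∀ p ∈ T, p ∉ G.Γ
  /-- The interface does not run along faces of elements. -/
  face_null : ∀ T ∈ 𝒯.elems, surf d (G.Γ ∩ frontier (simplex T)) = 0
  /-- Both parts of a cut element have positive measure. -/
  part_pos : ∀ T ∈ 𝒯.elems, (simplex T ∩ G.Γ).Nonempty →
    ∀ i, 0 < volume (simplex T ∩ G.sub i)
  /-- A cut element has a vertex in each of the two subdomains. -/
  vertex_mem : ∀ T ∈ 𝒯.elems, (simplex T ∩ G.Γ).Nonempty → ∀ i, ∃ p ∈ T, p ∈ G.sub i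

open Classical in
/-- The Heaviside function: `0` in `Ω₁`, `1` in `Ω₂`. -/
def heaviside (G : Geometry d) (x : EuclideanSpace ℝ (Fin d)) : ℝ :=
  if x ∈ G.sub 1 then 1 else 0

/-- The xfem basis function of the vertex `p`: nodal function times enrichment function. -/
def xhat (p x : EuclideanSpace ℝ (Fin d)) : ℝ :=
  𝒯.hat p x * |heaviside G x - heaviside G p|

open Classical in
/-- The index set `J_{Γ,l}`: the internal vertices in the *other* subdomain whose nodal function has
a support that is intersected by `Γ` in a set of positive surface measure. -/
def J (l : Fin 2) : Finset (EuclideanSpace ℝ (Fin d)) :=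
  𝒯.nodes.filter (fun p => 0 < surf d (G.Γ ∩ tsupport (𝒯.hat p)) ∧ p ∈ G.sub (1 - l))

/-- The xfem subspace `W_l`. -/
def W (l : Fin 2) : Submodule ℝ (EuclideanSpace ℝ (Fin d) → ℝ) :=
  Submodule.span ℝ (𝒯.xhat '' (𝒯.J l : Set (EuclideanSpace ℝ (Fin d))))

/-- The XFEM space, the sum of `V` and the two xfem subspaces. -/
def XFEM : Submodule ℝ (EuclideanSpace ℝ (Fin d) → ℝ) := 𝒯.V ⊔ 𝒯.W 0 ⊔ 𝒯.W 1

end Cut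

end Triangulation

section Forms

variable {d : ℕ} (G : Geometry d)

/-- The `L²` scalar product on `Ω`. -/
def l2 (u v : EuclideanSpace ℝ (Fin d) → ℝ) : ℝ := ∫ x in G.Ω, u x * v x

/-- The trace of `u` at a point of `Γ` from the side of the subdomain `sub i`. -/
def trace (i : Fin 2) (u : EuclideanSpace ℝ (Fin d) → ℝ) (x : EuclideanSpace ℝ (Fin d)) : ℝ :=
  limUnder (𝓝[G.sub i] x) u

/-- The trace of `∇u` at a point of `Γ` from the side of the subdomain `sub i`. -/
def gradTrace (i : Fin 2) (u : EuclideanSpace ℝ (Fin d) → ℝ) (x : EuclideanSpace ℝ (Fin d)) :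
    EuclideanSpace ℝ (Fin d) :=
  limUnder (𝓝[G.sub i] x) (gradient u)

/-- The jump across `Γ`. -/
def jump (u : EuclideanSpace ℝ (Fin d) → ℝ) (x : EuclideanSpace ℝ (Fin d)) : ℝ :=
  trace G 0 u x - trace G 1 u x

/-- The weighted average of `α ∇u · n` on `Γ ∩ T`, with the weights `κ_i = |T_i| / |T|`. -/
def average (α : Fin 2 → ℝ) (T : Finset (EuclideanSpace ℝ (Fin d)))
    (u : EuclideanSpace ℝ (Fin d) → ℝ) (x : EuclideanSpace ℝ (Fin d)) : ℝ :=
  ∑ i, (volume.real (simplex T ∩ G.sub i) / volume.real (simplex T)) *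
    (α i * inner ℝ (gradTrace G i u x) (G.n x))

variable {G} (𝒯 : Triangulation G.Ω)

/-- The consistency term `({α ∇u · n}, [v])_Γ`, as a sum over the elements. -/
def consistency (α : Fin 2 → ℝ) (u v : EuclideanSpace ℝ (Fin d) → ℝ) : ℝ :=
  ∑ T ∈ 𝒯.elems, ∫ x in G.Γ ∩ simplex T, average G α T u x * jump G v x ∂(surf d)

/-- The mesh-dependent scalar product of the jumps, `([u], [v])_{1/2,h,Γ}`. -/
def jumpForm (u v : EuclideanSpace ℝ (Fin d) → ℝ) : ℝ :=
  (𝒯.h)⁻¹ * ∫ x in G.Γ, jump G u x * jump G v x ∂(surf d)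

/-- The Nitsche bilinear form `a_h`. -/
def nitsche (α : Fin 2 → ℝ) (lam : ℝ) (u v : EuclideanSpace ℝ (Fin d) → ℝ) : ℝ :=
  (∑ i, α i * ∫ x in G.sub i, inner ℝ (gradient u x) (gradient v x))
    - consistency 𝒯 α u v - consistency 𝒯 α v u + lam * jumpForm 𝒯 u v

/-- The square of the mesh-dependent energy norm. -/
def energySq (lam : ℝ) (u : EuclideanSpace ℝ (Fin d) → ℝ) : ℝ :=
  (∑ i, ∫ x in G.sub i, ‖gradient u x‖ ^ 2) + lam * jumpForm 𝒯 u u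

/-- `A` is the Ritz operator `A_l` on `W_l`: `(A u, v)₀ = a_h(u, v)` for all `u, v ∈ W_l`. -/
def IsRitz (α : Fin 2 → ℝ) (lam : ℝ) (l : Fin 2) (A : 𝒯.W l →ₗ[ℝ] 𝒯.W l) : Prop :=
  ∀ u v : 𝒯.W l, l2 G (A u) v = nitsche 𝒯 α lam u v

/-- `B` is the Jacobi operator `B_l` on `W_l`: `(B u, v)₀ = ∑_j a_j b_j a_h(φ_j^Γ, φ_j^Γ)` for
`u = ∑_j a_j φ_j^Γ` and `v = ∑_j b_j φ_j^Γ`, the sums being over `J_{Γ,l}`. -/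
def IsJacobi (α : Fin 2 → ℝ) (lam : ℝ) (l : Fin 2) (B : 𝒯.W l →ₗ[ℝ] 𝒯.W l) : Prop :=
  ∀ (u v : 𝒯.W l) (a b : EuclideanSpace ℝ (Fin d) → ℝ),
    (u : EuclideanSpace ℝ (Fin d) → ℝ) = ∑ p ∈ 𝒯.J l, a p • 𝒯.xhat p →
    (v : EuclideanSpace ℝ (Fin d) → ℝ) = ∑ p ∈ 𝒯.J l, b p • 𝒯.xhat p →
    l2 G (B u) v = ∑ p ∈ 𝒯.J l, a p * b p * nitsche 𝒯 α lam (𝒯.xhat p) (𝒯.xhat p)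

/-- On the family `ℱ` of triangulations, `a_h(u, u)` is uniformly equivalent to the square of the
energy norm on the XFEM space. -/
def UniformNormEquiv (ℱ : Set (Triangulation G.Ω)) (α : Fin 2 → ℝ) (lam : ℝ) : Prop :=
  ∃ c C : ℝ, 0 < c ∧ 0 < C ∧ ∀ 𝒯 ∈ ℱ, ∀ u ∈ 𝒯.XFEM,
    c * energySq 𝒯 lam u ≤ nitsche 𝒯 α lam u u ∧ nitsche 𝒯 α lam u u ≤ C * energySq 𝒯 lam u

end Forms

end NitscheXFEM

end

/-! A function in `W l` vanishes on one side of the interface and is affine on each piece `simplex T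
∩ G.sub l`. Its energy is therefore a sum over elements of |T_l| |∇u|², plus a jump term. Once
`nitsche` is equivalent to the energy on `W l`, both spectral bounds say that the splitting of u
into multiples of single basis functions is stable in the energy, uniformly in how the interface
cuts the mesh.

One direction, `energy_le_sum`, is Cauchy–Schwarz: at most d + 1 basis functions are active on an
element. The other, `exists_sum_energy_le`, rests on `abs_coeff_le`. A cut element has a vertex in
`G.sub l`, where the affine extension of u from that side is zero, so each coefficient is at most
diam T times |∇u|, however small T_l is. The gradient terms of u and of its components carry the
same weight |T_l|, so small pieces do no harm.

The jump term of a basis function must also be bounded by the volumes |T_l|. This is done on the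
whole patch of the vertex (`exists_jumpInt_unitCoeff_le`). If the nodal function has the value v at
a point of the interface, it stays positive along a ray into `G.sub l` for a length comparable with
v h, because its slope there is at most σ μ / h (`hat_ray`). Integrating such lengths over Lipschitz
charts gives a volume by Fubini (`exists_lintegral_le_volume`).

The equivalence of `nitsche` with the energy is either assumed or follows from `exists_consInt_le`
by Young's inequality; the weight κ = |T_l| / |T| keeps the constant there independent of the cut.
The operators exist uniquely because the L² product is definite on the finite-dimensional `W l` and
the basis functions are linearly independent (`coeff_eq_zero_of_l2`). -/

noncomputable section

namespace NitscheXFEM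

/-! ### Barycentric coordinates and their gradients. -/

section Barycentric

variable {d : ℕ}

/-- Barycentric coordinates of a nondegenerate simplex, together with their gradients. -/
structure IsBary (T : Finset (EuclideanSpace ℝ (Fin d)))
    (β : EuclideanSpace ℝ (Fin d) → EuclideanSpace ℝ (Fin d) → ℝ)
    (g : EuclideanSpace ℝ (Fin d) → EuclideanSpace ℝ (Fin d)) : Prop where
  grad_eq_zero : ∀ p, p ∉ T → g p = 0
  eq_zero : ∀ p, p ∉ T → ∀ x, β p x = 0
  sub_eq : ∀ p x y, β p x - β p y = inner ℝ (g p) (x - y)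
  apply_vertex : ∀ p ∈ T, ∀ q ∈ T, β p q = if p = q then 1 else 0
  sum_eq_one : ∀ x, ∑ p ∈ T, β p x = 1
  sum_smul : ∀ x, ∑ p ∈ T, β p x • p = x
  mem_simplex_iff : ∀ x, x ∈ simplex T ↔ ∀ p, 0 ≤ β p x
  mem_interior_iff : ∀ x, x ∈ interior (simplex T) ↔ ∀ p ∈ T, 0 < β p x

theorem exists_isBary {T : Finset (EuclideanSpace ℝ (Fin d))} (hcard : T.card = d + 1)
    (hind : AffineIndependent ℝ ((↑) : T → EuclideanSpace ℝ (Fin d))) :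
    ∃ β g, IsBary T β g := by
  classical
  have htot : affineSpan ℝ (range ((↑) : T → EuclideanSpace ℝ (Fin d))) = ⊤ := by
    rw [hind.affineSpan_eq_top_iff_card_eq_finrank_add_one]
    simp [hcard]
  let b : AffineBasis T ℝ (EuclideanSpace ℝ (Fin d)) := ⟨(↑), hind, htot⟩
  have hb : ∀ p : T, b p = (p : EuclideanSpace ℝ (Fin d)) := fun p => rfl
  have hrange : range b = (T : Set (EuclideanSpace ℝ (Fin d))) := by
    rw [show (b : T → EuclideanSpace ℝ (Fin d)) = (↑) from rfl]
    exact Subtype.range_coe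
  refine ⟨fun p x => if h : p ∈ T then b.coord ⟨p, h⟩ x else 0,
    fun p => if h : p ∈ T then (InnerProductSpace.toDual ℝ (EuclideanSpace ℝ (Fin d))).symm
      (LinearMap.toContinuousLinearMap (b.coord ⟨p, h⟩).linear) else 0,
    ?_, ?_, ?_, ?_, ?_, ?_, ?_, ?_⟩
  · intro p hp
    simp [hp]
  · intro p hp x
    simp [hp]
  · intro p x y
    by_cases h : p ∈ T
    · simp only [h, dite_true, InnerProductSpace.toDual_symm_apply,
        LinearMap.coe_toContinuousLinearMap']
      have := (b.coord ⟨p, h⟩).linearMap_vsub x y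
      simpa using this.symm
    · simp [h]
  · intro p hp q hq
    have := b.coord_apply ⟨p, hp⟩ ⟨q, hq⟩
    rw [hb] at this
    simp [hp, this]
  · intro x
    rw [← Finset.sum_coe_sort]
    simpa using b.sum_coord_apply_eq_one x
  · intro x
    rw [← Finset.sum_coe_sort]
    have := b.linear_combination_coord_eq_self x
    simpa [hb] using this
  · intro x
    rw [simplex, ← hrange, b.convexHull_eq_nonneg_coord]
    constructor
    · intro h p
      by_cases hp : p ∈ T
      · simpa [hp] using h ⟨p, hp⟩
      · simp [hp]
    · intro h p
      simpa using h p
  · intro x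
    rw [simplex, ← hrange, b.interior_convexHull]
    constructor
    · intro h p hp
      simpa [hp] using h ⟨p, hp⟩
    · intro h p
      simpa using h p p.2

open Classical in
/-- The barycentric coordinate of `x` in the simplex `T` that belongs to the vertex `p`. -/
def bary (T : Finset (EuclideanSpace ℝ (Fin d))) :
    EuclideanSpace ℝ (Fin d) → EuclideanSpace ℝ (Fin d) → ℝ :=
  if h : ∃ β g, IsBary T β g then h.choose else 0

open Classical in
/-- The gradients of the barycentric coordinates of `T`. -/
def baryGrad (T : Finset (EuclideanSpace ℝ (Fin d))) :
    EuclideanSpace ℝ (Fin d) → EuclideanSpace ℝ (Fin d) :=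
  if h : ∃ β g, IsBary T β g then h.choose_spec.choose else 0

namespace IsBary

variable {T : Finset (EuclideanSpace ℝ (Fin d))}
  {β : EuclideanSpace ℝ (Fin d) → EuclideanSpace ℝ (Fin d) → ℝ}
  {g : EuclideanSpace ℝ (Fin d) → EuclideanSpace ℝ (Fin d)}

theorem apply_eq (H : IsBary T β g) (p x : EuclideanSpace ℝ (Fin d)) :
    β p x = β p 0 + inner ℝ (g p) x := by
  have := H.sub_eq p x 0
  rw [sub_zero] at this
  linarith

theorem continuous (H : IsBary T β g) (p : EuclideanSpace ℝ (Fin d)) : Continuous (β p) := by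
  have : β p = fun x => β p 0 + inner ℝ (g p) x := funext (H.apply_eq p)
  rw [this]
  fun_prop

theorem eq_of_sum (H : IsBary T β g) {w : EuclideanSpace ℝ (Fin d) → ℝ}
    {x : EuclideanSpace ℝ (Fin d)} (h1 : ∑ q ∈ T, w q = 1) (hx : ∑ q ∈ T, w q • q = x)
    {p : EuclideanSpace ℝ (Fin d)} (hp : p ∈ T) : β p x = w p := by
  classical
  have h2 : β p x = ∑ q ∈ T, w q * β p q := by
    calc β p x = β p 0 + inner ℝ (g p) x := H.apply_eq p x
      _ = (∑ q ∈ T, w q) * β p 0 + ∑ q ∈ T, w q * inner ℝ (g p) q := by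
          rw [h1, ← hx, inner_sum]
          simp [inner_smul_right]
      _ = ∑ q ∈ T, w q * β p q := by
          rw [Finset.sum_mul, ← Finset.sum_add_distrib]
          refine Finset.sum_congr rfl fun q _ => ?_
          rw [H.apply_eq p q]
          ring
  rw [h2, Finset.sum_eq_single p]
  · rw [H.apply_vertex p hp p hp]
    simp
  · intro q hq hqp
    rw [H.apply_vertex p hp q hq, if_neg (Ne.symm hqp), mul_zero]
  · exact fun h => absurd hp h

theorem le_one (H : IsBary T β g) {p x : EuclideanSpace ℝ (Fin d)} (hx : x ∈ simplex T) :
    β p x ≤ 1 := by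
  by_cases hp : p ∈ T
  · rw [← H.sum_eq_one x]
    exact Finset.single_le_sum (f := fun q => β q x)
      (fun q _ => (H.mem_simplex_iff x).1 hx q) hp
  · rw [H.eq_zero p hp]
    exact zero_le_one

/-- Moving from the centre of the ball by r in the gradient direction raises the coordinate by r‖g
p‖, and it stays between 0 and 1 on the simplex. -/
theorem norm_grad_le (H : IsBary T β g) {c : EuclideanSpace ℝ (Fin d)} {r : ℝ} (hr : 0 < r)
    (hball : Metric.closedBall c r ⊆ simplex T) (p : EuclideanSpace ℝ (Fin d)) :
    ‖g p‖ ≤ 1 / r := by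
  by_cases hg : g p = 0
  · rw [hg, norm_zero]
    positivity
  have hg' : 0 < ‖g p‖ := norm_pos_iff.2 hg
  have hmem : c + (r / ‖g p‖) • g p ∈ simplex T := by
    apply hball
    rw [mem_closedBall_iff_norm, add_sub_cancel_left, norm_smul,
      Real.norm_of_nonneg (by positivity)]
    exact le_of_eq (by field_simp)
  have hc : c ∈ simplex T := hball (Metric.mem_closedBall_self hr.le)
  have h1 := H.sub_eq p (c + (r / ‖g p‖) • g p) c
  rw [add_sub_cancel_left, inner_smul_right, real_inner_self_eq_norm_sq] at h1
  have h2 := H.le_one (p := p) hmem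
  have h3 := (H.mem_simplex_iff c).1 hc p
  rw [le_div_iff₀ hr]
  have h4 : r / ‖g p‖ * ‖g p‖ ^ 2 = ‖g p‖ * r := by field_simp
  linarith

end IsBary

theorem isBary_bary {T : Finset (EuclideanSpace ℝ (Fin d))} (hcard : T.card = d + 1)
    (hind : AffineIndependent ℝ ((↑) : T → EuclideanSpace ℝ (Fin d))) :
    IsBary T (bary T) (baryGrad T) := by
  have h := exists_isBary hcard hind
  simp only [bary, baryGrad, h, dite_true]
  exact h.choose_spec.choose_spec

end Barycentric

/-! ### Topology and measure of simplices. -/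

section Simplex

variable {d : ℕ} {T : Finset (EuclideanSpace ℝ (Fin d))}

theorem convex_simplex : Convex ℝ (simplex T) := convex_convexHull ℝ _

theorem isCompact_simplex : IsCompact (simplex T) :=
  T.finite_toSet.isCompact_convexHull ℝ

theorem isClosed_simplex : IsClosed (simplex T) := isCompact_simplex.isClosed

theorem vertex_mem_simplex {p : EuclideanSpace ℝ (Fin d)} (hp : p ∈ T) : p ∈ simplex T :=
  subset_convexHull ℝ _ hp

theorem measurableSet_simplex : MeasurableSet (simplex T) := isClosed_simplex.measurableSet

theorem volume_frontier_simplex : volume (frontier (simplex T)) = 0 :=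
  convex_simplex.addHaar_frontier volume

theorem volume_simplex_lt_top : volume (simplex T) < ⊤ := isCompact_simplex.measure_lt_top

theorem dist_le_diam_simplex {x y : EuclideanSpace ℝ (Fin d)} (hx : x ∈ simplex T)
    (hy : y ∈ simplex T) : dist x y ≤ Metric.diam (simplex T) :=
  Metric.dist_le_diam_of_mem isCompact_simplex.isBounded hx hy

end Simplex

/-! ### Nodal functions of a conforming triangulation. -/

namespace Triangulation

variable {d : ℕ} {Ω : Set (EuclideanSpace ℝ (Fin d))} (𝒯 : Triangulation Ω)
  {T T' : Finset (EuclideanSpace ℝ (Fin d))}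

theorem isBary (hT : T ∈ 𝒯.elems) : IsBary T (bary T) (baryGrad T) :=
  isBary_bary (𝒯.card_eq T hT) (𝒯.indep T hT)

/-- By conformity a point common to two elements is a convex combination of their common vertices,
so both elements assign it the same coordinates. -/
theorem hat_eq_bary (hT : T ∈ 𝒯.elems) {x : EuclideanSpace ℝ (Fin d)} (hx : x ∈ simplex T)
    (p : EuclideanSpace ℝ (Fin d)) : 𝒯.hat p x = bary T p x := by
  classical
  have H := 𝒯.isBary hT
  have hset : {t : ℝ | ∃ T ∈ 𝒯.elems, ∃ w : EuclideanSpace ℝ (Fin d) → ℝ,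
      (∀ q, 0 ≤ w q) ∧ (∀ q, q ∉ T → w q = 0) ∧ ∑ q ∈ T, w q = 1 ∧ ∑ q ∈ T, w q • q = x ∧
        t = w p} = {bary T p x} := by
    ext t
    simp only [mem_ofPred_eq, mem_singleton_iff]
    constructor
    · rintro ⟨S, hS, w, hw0, hwS, hw1, hwx, rfl⟩
      have HS := 𝒯.isBary hS
      have hxS : x ∈ simplex S := by
        rw [HS.mem_simplex_iff]
        intro q
        by_cases hq : q ∈ S
        · rw [HS.eq_of_sum hw1 hwx hq]
          exact hw0 q
        · rw [HS.eq_zero q hq]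
      have hmem : x ∈ simplex T ∩ simplex S := ⟨hx, hxS⟩
      rw [𝒯.conforming T hT S hS, ← Finset.coe_inter, Finset.mem_convexHull'] at hmem
      obtain ⟨v, hv0, hv1, hvx⟩ := hmem
      -- The weights on the common vertices, extended by zero, are the barycentric coordinates in
      -- every element that has these vertices.
      have key : ∀ R ∈ 𝒯.elems, T ∩ S ⊆ R → ∀ q ∈ R,
          bary R q x = if q ∈ T ∩ S then v q else 0 := by
        intro R hR hsub q hq
        refine (𝒯.isBary hR).eq_of_sum (w := fun q => if q ∈ T ∩ S then v q else 0) ?_ ?_ hq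
        · rw [← hv1, ← Finset.sum_filter]
          congr 1
          ext y
          simp only [Finset.mem_filter]
          exact ⟨fun h => h.2, fun h => ⟨hsub h, h⟩⟩
        · rw [← hvx]
          simp only [ite_smul, zero_smul]
          rw [← Finset.sum_filter]
          congr 1
          ext y
          simp only [Finset.mem_filter]
          exact ⟨fun h => h.2, fun h => ⟨hsub h, h⟩⟩
      have keyT := key T hT Finset.inter_subset_left p
      have keyS := key S hS Finset.inter_subset_right p
      by_cases hpS : p ∈ S
      · rw [← HS.eq_of_sum hw1 hwx hpS, keyS hpS]
        by_cases hpT : p ∈ T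
        · rw [keyT hpT]
        · rw [H.eq_zero p hpT, if_neg (fun h => hpT (Finset.mem_inter.1 h).1)]
      · rw [hwS p hpS]
        by_cases hpT : p ∈ T
        · rw [keyT hpT, if_neg (fun h => hpS (Finset.mem_inter.1 h).2)]
        · rw [H.eq_zero p hpT]
    · rintro rfl
      exact ⟨T, hT, fun q => bary T q x, (H.mem_simplex_iff x).1 hx,
        fun q hq => H.eq_zero q hq x, H.sum_eq_one x, H.sum_smul x, rfl⟩
  rw [hat, hset, csSup_singleton]

/-- Distinct elements have equally many vertices, so T has a vertex that T' lacks. Its nodal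
function is positive inside T and zero on T'. -/
theorem disjoint_interior_simplex (hT : T ∈ 𝒯.elems) (hT' : T' ∈ 𝒯.elems) (hne : T ≠ T') :
    Disjoint (interior (simplex T)) (simplex T') := by
  classical
  rw [Set.disjoint_left]
  intro x hx hx'
  have H := 𝒯.isBary hT
  have hcard : T'.card ≤ T.card := by rw [𝒯.card_eq T hT, 𝒯.card_eq T' hT']
  obtain ⟨q, hq, hq'⟩ : ∃ q ∈ T, q ∉ T' := by
    by_contra! h
    exact hne (Finset.eq_of_subset_of_card_le h hcard)
  have hpos := (H.mem_interior_iff x).1 hx q hq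
  rw [← 𝒯.hat_eq_bary hT (interior_subset hx), 𝒯.hat_eq_bary hT' hx',
    (𝒯.isBary hT').eq_zero q hq'] at hpos
  exact lt_irrefl _ hpos

theorem simplex_subset (hT : T ∈ 𝒯.elems) : simplex T ⊆ closure Ω := by
  rw [← 𝒯.cover]
  exact Set.subset_biUnion_of_mem (u := fun T : Finset (EuclideanSpace ℝ (Fin d)) => simplex T) hT

theorem exists_mem_simplex {x : EuclideanSpace ℝ (Fin d)} (hx : x ∈ Ω) :
    ∃ T ∈ 𝒯.elems, x ∈ simplex T := by
  have := subset_closure hx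
  rw [← 𝒯.cover] at this
  simpa using this

theorem diam_le_h (hT : T ∈ 𝒯.elems) : Metric.diam (simplex T) ≤ 𝒯.h :=
  le_ciSup (f := fun T : 𝒯.elems => Metric.diam (simplex (T : Finset (EuclideanSpace ℝ (Fin d)))))
    (Set.finite_range _).bddAbove ⟨T, hT⟩

theorem hat_eq_zero {p x : EuclideanSpace ℝ (Fin d)}
    (hx : ∀ T ∈ 𝒯.elems, p ∈ T → x ∉ simplex T) : 𝒯.hat p x = 0 := by
  classical
  by_cases h : ∃ T ∈ 𝒯.elems, x ∈ simplex T
  · obtain ⟨T, hT, hxT⟩ := h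
    rw [𝒯.hat_eq_bary hT hxT, (𝒯.isBary hT).eq_zero]
    exact fun hp => hx T hT hp hxT
  · push Not at h
    rw [hat]
    convert Real.sSup_empty
    rw [Set.eq_empty_iff_forall_notMem]
    rintro t ⟨T, hT, w, hw0, -, hw1, hwx, -⟩
    refine h T hT ?_
    rw [(𝒯.isBary hT).mem_simplex_iff]
    intro q
    by_cases hq : q ∈ T
    · rw [(𝒯.isBary hT).eq_of_sum hw1 hwx hq]
      exact hw0 q
    · rw [(𝒯.isBary hT).eq_zero q hq]

theorem hat_nonneg (p x : EuclideanSpace ℝ (Fin d)) : 0 ≤ 𝒯.hat p x := by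
  by_cases h : ∃ T ∈ 𝒯.elems, p ∈ T ∧ x ∈ simplex T
  · obtain ⟨T, hT, -, hxT⟩ := h
    rw [𝒯.hat_eq_bary hT hxT]
    exact ((𝒯.isBary hT).mem_simplex_iff x).1 hxT p
  · push Not at h
    exact (𝒯.hat_eq_zero h).ge

theorem hat_le_one (p x : EuclideanSpace ℝ (Fin d)) : 𝒯.hat p x ≤ 1 := by
  by_cases h : ∃ T ∈ 𝒯.elems, p ∈ T ∧ x ∈ simplex T
  · obtain ⟨T, hT, -, hxT⟩ := h
    rw [𝒯.hat_eq_bary hT hxT]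
    exact (𝒯.isBary hT).le_one hxT
  · push Not at h
    exact (𝒯.hat_eq_zero h).trans_le zero_le_one

theorem tsupport_hat_subset (p : EuclideanSpace ℝ (Fin d)) :
    tsupport (𝒯.hat p) ⊆ ⋃ T ∈ {T ∈ (𝒯.elems : Set (Finset (EuclideanSpace ℝ (Fin d)))) | p ∈ T},
      simplex T := by
  refine closure_minimal ?_ ?_
  · intro x hx
    by_contra hcon
    refine hx (𝒯.hat_eq_zero fun T hT hp hxT => hcon ?_)
    exact Set.mem_biUnion (show T ∈ {T ∈ (𝒯.elems : Set _) | p ∈ T} from ⟨hT, hp⟩) hxT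
  · exact (𝒯.elems.finite_toSet.subset (sep_subset _ _)).isClosed_biUnion
      fun T _ => isClosed_simplex

end Triangulation

/-! ### Elementary properties of the subdomains and the interface. -/

namespace Geometry

variable {d : ℕ} (G : Geometry d)

theorem disjoint_sub' (l : Fin 2) : Disjoint (G.sub l) (G.sub (1 - l)) := by
  fin_cases l
  · exact G.disjoint_sub
  · exact G.disjoint_sub.symm

theorem Γ_subset_frontier (i : Fin 2) : G.Γ ⊆ frontier (G.sub i) := by
  fin_cases i
  · exact inter_subset_left
  · exact inter_subset_right

theorem disjoint_Γ_sub (i : Fin 2) : Disjoint G.Γ (G.sub i) :=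
  (disjoint_frontier_iff_isOpen.2 (G.isOpen_sub i)).mono_left (G.Γ_subset_frontier i)

theorem Ω_eq (l : Fin 2) : G.Ω = G.sub l ∪ G.sub (1 - l) ∪ G.Γ := by
  fin_cases l
  · exact G.union_eq
  · exact G.union_eq.trans (by rw [union_comm (G.sub 0)]; rfl)

theorem sub_subset (i : Fin 2) : G.sub i ⊆ G.Ω := by
  rw [G.Ω_eq i]
  exact fun x hx => Or.inl (Or.inl hx)

theorem Γ_subset : G.Γ ⊆ G.Ω := by
  rw [G.Ω_eq 0]
  exact subset_union_right

theorem isClosed_Γ : IsClosed G.Γ := isClosed_frontier.inter isClosed_frontier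

theorem isCompact_Γ : IsCompact G.Γ :=
  Metric.isCompact_of_isClosed_isBounded G.isClosed_Γ (G.bounded_Ω.subset G.Γ_subset)

theorem measurableSet_Γ : MeasurableSet G.Γ := G.isClosed_Γ.measurableSet

theorem neBot_nhdsWithin_sub (i : Fin 2) {x : EuclideanSpace ℝ (Fin d)} (hx : x ∈ G.Γ) :
    (𝓝[G.sub i] x).NeBot :=
  mem_closure_iff_nhdsWithin_neBot.1 (frontier_subset_closure (G.Γ_subset_frontier i hx))

end Geometry

/-! ### Mesh size, cut elements and the slope of nodal functions. -/

namespace Triangulation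

variable {d : ℕ} {G : Geometry d} (𝒯 : Triangulation G.Ω) {σ μ : ℝ}
  {T : Finset (EuclideanSpace ℝ (Fin d))}

theorem diam_pos (hd : 0 < d) (hT : T ∈ 𝒯.elems) : 0 < Metric.diam (simplex T) := by
  have hcard : 1 < T.card := by
    rw [𝒯.card_eq T hT]
    omega
  obtain ⟨p, hp, q, hq, hpq⟩ := Finset.one_lt_card.1 hcard
  exact (dist_pos.2 hpq).trans_le
    (dist_le_diam_simplex (vertex_mem_simplex hp) (vertex_mem_simplex hq))

theorem exists_mem_elems : ∃ T, T ∈ 𝒯.elems := by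
  obtain ⟨x, hx⟩ := G.connected_Ω.nonempty
  obtain ⟨T, hT, -⟩ := 𝒯.exists_mem_simplex hx
  exact ⟨T, hT⟩

theorem h_pos (hd : 0 < d) : 0 < 𝒯.h := by
  obtain ⟨T, hT⟩ := 𝒯.exists_mem_elems
  exact (𝒯.diam_pos hd hT).trans_le (𝒯.diam_le_h hT)

theorem h_le_diam : 𝒯.h ≤ Metric.diam G.Ω := by
  refine Real.iSup_le (fun T => ?_) Metric.diam_nonneg
  rw [← Metric.diam_closure G.Ω]
  exact Metric.diam_mono (𝒯.simplex_subset T.2) G.bounded_Ω.closure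

theorem interior_simplex_subset (hT : T ∈ 𝒯.elems) : interior (simplex T) ⊆ G.Ω := by
  rw [← G.interior_closure_Ω]
  exact interior_mono (𝒯.simplex_subset hT)

theorem closure_interior_simplex (hT : T ∈ 𝒯.elems) :
    closure (interior (simplex T)) = simplex T := by
  rw [convex_simplex.closure_interior_eq_closure_of_nonempty_interior, isClosed_simplex.closure_eq]
  refine ⟨T.centroid ℝ id, ?_⟩
  have hne : T.card ≠ 0 := by
    rw [𝒯.card_eq T hT]
    omega
  rw [(𝒯.isBary hT).mem_interior_iff]
  intro p hp
  rw [(𝒯.isBary hT).eq_of_sum (w := fun _ => (T.card : ℝ)⁻¹) ?_ ?_ hp]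
  · positivity
  · rw [Finset.sum_const, nsmul_eq_mul, mul_inv_cancel₀]
    exact_mod_cast hne
  · rw [Finset.centroid_eq_centerMass _ (Finset.card_ne_zero.1 hne), Finset.centerMass_eq_of_sum_1]
    · simp [Finset.centroidWeights_apply]
    · exact T.sum_centroidWeights_eq_one_of_card_ne_zero ℝ hne

/-- An element with a vertex in one subdomain that meets the other subdomain is cut. -/
theorem cut_of_mem {l : Fin 2} (hT : T ∈ 𝒯.elems) {p x : EuclideanSpace ℝ (Fin d)}
    (hpT : p ∈ T) (hp : p ∈ G.sub (1 - l)) (hxT : x ∈ simplex T) (hx : x ∈ G.sub l) :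
    (simplex T ∩ G.Γ).Nonempty := by
  by_contra hcon
  -- The argument runs in the interior because the closed element may touch the boundary of `G.Ω`.
  -- Without interface points, the interior would be a connected set covered by two disjoint open
  -- sets that both meet it.
  have hpre : IsPreconnected (interior (simplex T)) := convex_simplex.interior.isPreconnected
  have key : ∀ i, ∀ y ∈ simplex T, y ∈ G.sub i →
      (interior (simplex T) ∩ G.sub i).Nonempty := by
    intro i y hy hyi
    rw [← 𝒯.closure_interior_simplex hT] at hy
    rw [inter_comm]
    exact mem_closure_iff.1 hy _ (G.isOpen_sub i) hyi
  have hsub : interior (simplex T) ⊆ G.sub l ∪ G.sub (1 - l) := by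
    intro y hy
    have := 𝒯.interior_simplex_subset hT hy
    rw [G.Ω_eq l] at this
    rcases this with h | h
    · exact h
    · exact absurd ⟨y, interior_subset hy, h⟩ hcon
  obtain ⟨z, -, hz1, hz2⟩ := hpre _ _ (G.isOpen_sub l) (G.isOpen_sub (1 - l)) hsub
    (key l x hxT hx) (key (1 - l) p (vertex_mem_simplex hpT) hp)
  exact Set.disjoint_left.1 (G.disjoint_sub' l) hz1 hz2

variable {𝒯}

namespace Admissible

theorem norm_baryGrad_le (hA : 𝒯.Admissible σ μ) (hd : 0 < d) (hT : T ∈ 𝒯.elems)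
    (p : EuclideanSpace ℝ (Fin d)) : ‖baryGrad T p‖ ≤ σ / Metric.diam (simplex T) := by
  obtain ⟨c, r, hr, hball, hσ⟩ := hA.shape_regular T hT
  have hdiam := 𝒯.diam_pos hd hT
  refine ((𝒯.isBary hT).norm_grad_le hr hball p).trans ?_
  rw [div_le_div_iff₀ hr hdiam]
  linarith

theorem σ_pos (hA : 𝒯.Admissible σ μ) (hd : 0 < d) : 0 < σ := by
  obtain ⟨T, hT⟩ := 𝒯.exists_mem_elems
  obtain ⟨c, r, hr, -, hσ⟩ := hA.shape_regular T hT
  have hdiam := 𝒯.diam_pos hd hT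
  by_contra! h
  nlinarith

theorem μ_pos (hA : 𝒯.Admissible σ μ) (hd : 0 < d) (hT : T ∈ 𝒯.elems)
    (hcut : (simplex T ∩ G.Γ).Nonempty) : 0 < μ := by
  have h1 := hA.quasi_uniform T hT hcut
  have h2 := 𝒯.h_pos hd
  have h3 := 𝒯.diam_pos hd hT
  by_contra! h
  nlinarith

theorem norm_baryGrad_le_of_cut (hA : 𝒯.Admissible σ μ) (hd : 0 < d) (hT : T ∈ 𝒯.elems)
    (hcut : (simplex T ∩ G.Γ).Nonempty) (p : EuclideanSpace ℝ (Fin d)) :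
    ‖baryGrad T p‖ ≤ σ * μ / 𝒯.h := by
  refine (hA.norm_baryGrad_le hd hT p).trans ?_
  rw [div_le_div_iff₀ (𝒯.diam_pos hd hT) (𝒯.h_pos hd), mul_assoc]
  exact mul_le_mul_of_nonneg_left (hA.quasi_uniform T hT hcut) (hA.σ_pos hd).le

/-- Along a ray inside the other subdomain, a nodal function decreases at most at the rate
`σ μ / h`. -/
theorem hat_ray (hA : 𝒯.Admissible σ μ) (hd : 0 < d) {l : Fin 2} {p x e : EuclideanSpace ℝ (Fin d)}
    (hp : p ∈ G.sub (1 - l)) (hx : x ∈ G.Ω) (he : ‖e‖ = 1) {s : ℝ}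
    (hs : ∀ t ∈ Ioo 0 s, x + t • e ∈ G.sub l) (hK : 0 ≤ σ * μ / 𝒯.h) {τ : ℝ} (hτ : τ ∈ Ico 0 s) :
    𝒯.hat p x ≤ 𝒯.hat p (x + τ • e) + σ * μ / 𝒯.h * τ := by
  set K := σ * μ / 𝒯.h with hKdef
  have hΩ : ∀ t ∈ Icc 0 τ, x + t • e ∈ G.Ω := by
    intro t ht
    rcases eq_or_lt_of_le ht.1 with h | h
    · rw [← h]
      simpa using hx
    · exact G.sub_subset l (hs t ⟨h, ht.2.trans_lt hτ.2⟩)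
  let S : Set ℝ := {t | 𝒯.hat p x ≤ 𝒯.hat p (x + t • e) + K * t}
  suffices h : Icc 0 τ ⊆ S from h ⟨hτ.1, le_rfl⟩
  have hcont : Continuous fun t : ℝ => x + t • e := by fun_prop
  -- Continuous induction along the ray: the estimate holds on a closed set of parameters and can be
  -- continued to the right of each of its points before τ.
  refine IsClosed.Icc_subset_of_forall_exists_gt ?_ ?_ ?_
  · have hS : S ∩ Icc 0 τ = ⋃ T ∈ (𝒯.elems : Set (Finset (EuclideanSpace ℝ (Fin d)))),
        (fun t : ℝ => x + t • e) ⁻¹' simplex T ∩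
          ({t | 𝒯.hat p x ≤ bary T p (x + t • e) + K * t} ∩ Icc 0 τ) := by
      ext t
      simp only [mem_iUnion, mem_inter_iff, exists_prop, mem_preimage, S, mem_ofPred_eq]
      constructor
      · rintro ⟨h1, h2⟩
        obtain ⟨T, hT, hxT⟩ := 𝒯.exists_mem_simplex (hΩ t h2)
        rw [𝒯.hat_eq_bary hT hxT] at h1
        exact ⟨T, hT, hxT, h1, h2⟩
      · rintro ⟨T, hT, hxT, h1, h2⟩
        rw [← 𝒯.hat_eq_bary hT hxT] at h1
        exact ⟨h1, h2⟩
    rw [hS]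
    refine 𝒯.elems.finite_toSet.isClosed_biUnion fun T hT => ?_
    have := (𝒯.isBary hT).continuous p
    exact (isClosed_simplex.preimage hcont).inter
      ((isClosed_le continuous_const (by fun_prop)).inter isClosed_Icc)
  · simp [S]
  · rintro t ⟨htS, ht⟩ y hy
    have hev : ∀ᶠ t' in 𝓝[>] t, t' ∈ Ioc t y ∧ t' < τ :=
      (show ∀ᶠ t' in 𝓝[>] t, t' ∈ Ioc t y from Ioc_mem_nhdsGT (mem_Ioi.1 hy)).and
        (mem_of_superset (Ioo_mem_nhdsGT ht.2) fun _ h => h.2)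
    -- There are finitely many elements, so one of them contains ray points with parameters
    -- arbitrarily close to t from the right. Being closed, it contains the point at t as well, and
    -- the nodal function is affine on it.
    have hfreq : ∃ T ∈ 𝒯.elems, ∃ᶠ t' in 𝓝[>] t, x + t' • e ∈ simplex T := by
      by_contra! hcon
      have h1 : ∀ᶠ t' in 𝓝[>] t, ∀ T ∈ 𝒯.elems, x + t' • e ∉ simplex T :=
        (Filter.eventually_all_finset _).2 hcon
      obtain ⟨t', h2, h3, h4⟩ := (h1.and hev).exists
      obtain ⟨T, hT, h5⟩ := 𝒯.exists_mem_simplex (hΩ t' ⟨ht.1.trans h3.1.le, h4.le⟩)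
      exact h2 T hT h5
    obtain ⟨T, hT, hfr⟩ := hfreq
    have htT : x + t • e ∈ simplex T := by
      have : t ∈ (fun t : ℝ => x + t • e) ⁻¹' simplex T :=
        (isClosed_simplex.preimage hcont).mem_of_frequently_of_tendsto hfr
          (tendsto_id.mono_left nhdsWithin_le_nhds)
      exact this
    obtain ⟨t', h1, h2, h3⟩ := (hfr.and_eventually hev).exists
    refine ⟨t', ?_, h2⟩
    -- An element with vertex p that meets `G.sub l` is cut, so quasi-uniformity bounds the
    -- gradient; on an element without p the gradient is zero.
    have hgrad : ‖baryGrad T p‖ ≤ K := by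
      by_cases hpT : p ∈ T
      · exact hA.norm_baryGrad_le_of_cut hd hT (𝒯.cut_of_mem hT hpT hp h1
          (hs t' ⟨ht.1.trans_lt h2.1, h3.trans hτ.2⟩)) p
      · rw [(𝒯.isBary hT).grad_eq_zero p hpT, norm_zero]
        exact hK
    have h4 := (𝒯.isBary hT).sub_eq p (x + t • e) (x + t' • e)
    have h5 : x + t • e - (x + t' • e) = (t - t') • e := by
      rw [sub_smul]
      abel
    have h6 : inner ℝ (baryGrad T p) (x + t • e - (x + t' • e)) ≤ K * (t' - t) := by
      refine (real_inner_le_norm _ _).trans ?_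
      rw [h5, norm_smul, he, mul_one, Real.norm_eq_abs, abs_sub_comm,
        abs_of_pos (sub_pos.2 h2.1)]
      exact mul_le_mul_of_nonneg_right hgrad (sub_pos.2 h2.1).le
    rw [← 𝒯.hat_eq_bary hT htT, ← 𝒯.hat_eq_bary hT h1] at h4
    simp only [S, mem_ofPred_eq] at htS ⊢
    linarith

end Admissible

theorem J_subset_sub {l : Fin 2} {p : EuclideanSpace ℝ (Fin d)} (hp : p ∈ 𝒯.J l) :
    p ∈ G.sub (1 - l) := by
  classical
  exact (Finset.mem_filter.1 hp).2.2

theorem exists_cut_of_mem_J {l : Fin 2} {p : EuclideanSpace ℝ (Fin d)} (hp : p ∈ 𝒯.J l) :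
    ∃ T ∈ 𝒯.elems, p ∈ T ∧ (simplex T ∩ G.Γ).Nonempty := by
  classical
  have h := (Finset.mem_filter.1 hp).2.1
  obtain ⟨x, hx, hx'⟩ := nonempty_of_measure_ne_zero h.ne'
  have := 𝒯.tsupport_hat_subset p hx'
  simp only [mem_iUnion, exists_prop] at this
  obtain ⟨T, ⟨hT, hpT⟩, hxT⟩ := this
  exact ⟨T, hT, hpT, x, hxT, hx⟩

end Triangulation

/-! ### Lipschitz graphs: surface measure and Fubini along lines. -/

section LipschitzGraph

open scoped ENNReal

variable {d : ℕ} {e : EuclideanSpace ℝ (Fin d)} {ψ : EuclideanSpace ℝ (Fin d) → ℝ} {L : ℝ≥0}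

/-- The parametrization of the graph `{x | ⟪e, x⟫ = ψ x}` over the hyperplane orthogonal to `e`. -/
def graphMap (e : EuclideanSpace ℝ (Fin d)) (ψ : EuclideanSpace ℝ (Fin d) → ℝ)
    (y : (ℝ ∙ e)ᗮ) : EuclideanSpace ℝ (Fin d) :=
  y + ψ y • e

/-- The orthogonal projection onto the hyperplane orthogonal to `e`. -/
def hyperProj (e : EuclideanSpace ℝ (Fin d)) : EuclideanSpace ℝ (Fin d) →L[ℝ] (ℝ ∙ e)ᗮ :=
  (ℝ ∙ e)ᗮ.orthogonalProjectionOnto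

theorem hyperProj_add (he : ‖e‖ = 1) (x : EuclideanSpace ℝ (Fin d)) :
    (hyperProj e x : EuclideanSpace ℝ (Fin d)) + (inner ℝ e x : ℝ) • e = x := by
  have := Submodule.starProjection_add_starProjection_orthogonal (K := ℝ ∙ e) x
  rw [Submodule.starProjection_unit_singleton ℝ he] at this
  rw [add_comm]
  exact this

theorem hyperProj_coe_add (y : (ℝ ∙ e)ᗮ) (t : ℝ) :
    hyperProj e ((y : EuclideanSpace ℝ (Fin d)) + t • e) = y := by
  rw [map_add, map_smul]
  have h1 : hyperProj e (y : EuclideanSpace ℝ (Fin d)) = y :=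
    Submodule.orthogonalProjectionOnto_mem_subspace_eq_self y
  have h2 : hyperProj e e = 0 :=
    Submodule.orthogonalProjectionOnto_orthogonalComplement_singleton_eq_zero e
  rw [h1, h2, smul_zero, add_zero]

theorem hyperProj_graphMap (y : (ℝ ∙ e)ᗮ) : hyperProj e (graphMap e ψ y) = y :=
  hyperProj_coe_add y _

theorem eq_comp_hyperProj (he : ‖e‖ = 1) (hinv : ∀ y, ∀ t : ℝ, ψ (y + t • e) = ψ y)
    (x : EuclideanSpace ℝ (Fin d)) : ψ x = ψ (hyperProj e x) := by
  conv_lhs => rw [← hyperProj_add he x]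
  exact hinv _ _

theorem graphMap_hyperProj (he : ‖e‖ = 1) (hinv : ∀ y, ∀ t : ℝ, ψ (y + t • e) = ψ y)
    {x : EuclideanSpace ℝ (Fin d)} (hx : inner ℝ e x = ψ x) : graphMap e ψ (hyperProj e x) = x := by
  rw [graphMap, ← eq_comp_hyperProj he hinv, ← hx, hyperProj_add he]

theorem finrank_hyperplane (he : ‖e‖ = 1) : Module.finrank ℝ (ℝ ∙ e)ᗮ = d - 1 := by
  have h := (ℝ ∙ e).finrank_add_finrank_orthogonal
  have hne : e ≠ 0 := by
    rintro rfl
    simp at he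
  rw [finrank_span_singleton hne, finrank_euclideanSpace_fin] at h
  omega

theorem lipschitzWith_graphMap (he : ‖e‖ = 1) (hψ : LipschitzWith L ψ) :
    LipschitzWith (1 + L) (graphMap e ψ) := by
  refine LipschitzWith.add (LipschitzWith.subtype_val _) ?_
  refine LipschitzWith.of_dist_le_mul fun y z => ?_
  rw [dist_eq_norm, ← sub_smul, norm_smul, he, mul_one, ← dist_eq_norm]
  exact hψ.dist_le_mul _ _

/-- A K-Lipschitz map enlarges (d-1)-dimensional Hausdorff measure by at most the factor K^(d-1). On
the hyperplane, Hausdorff measure in the Euclidean normalization is Lebesgue measure. -/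
theorem surf_image_graphMap_le (he : ‖e‖ = 1) (hψ : LipschitzWith L ψ) (A : Set (ℝ ∙ e)ᗮ) :
    surf d (graphMap e ψ '' A) ≤ ((1 + L : ℝ≥0) : ℝ≥0∞) ^ (d - 1) * volume A := by
  have h1 := (lipschitzWith_graphMap he hψ).hausdorffMeasure_image_le
    (d := ((d - 1 : ℕ) : ℝ)) (Nat.cast_nonneg _) A
  rw [ENNReal.rpow_natCast] at h1
  have h2 : (volume : Measure (ℝ ∙ e)ᗮ) = Measure.euclideanHausdorffMeasure (d - 1) := by
    rw [← InnerProductSpace.euclideanHausdorffMeasure_eq_volume, finrank_hyperplane he]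
  rw [h2, surf, Measure.euclideanHausdorffMeasure_def, Measure.euclideanHausdorffMeasure_def,
    Measure.smul_apply, Measure.smul_apply, ENNReal.smul_def, ENNReal.smul_def, smul_eq_mul,
    smul_eq_mul, mul_left_comm]
  gcongr

theorem surf_inter_graph_le (he : ‖e‖ = 1) (hψ : LipschitzWith L ψ)
    (hinv : ∀ y, ∀ t : ℝ, ψ (y + t • e) = ψ y) (A : Set (EuclideanSpace ℝ (Fin d))) :
    surf d (A ∩ {x | inner ℝ e x = ψ x}) ≤
      ((1 + L : ℝ≥0) : ℝ≥0∞) ^ (d - 1) * volume (graphMap e ψ ⁻¹' A) := by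
  refine (measure_mono ?_).trans (surf_image_graphMap_le he hψ _)
  rintro x ⟨hxA, hx⟩
  exact ⟨hyperProj e x, by rwa [mem_preimage, graphMap_hyperProj he hinv hx],
    graphMap_hyperProj he hinv hx⟩

/-- This is the upper half of the area formula with a crude constant in place of the Jacobian, so a
comparison of measures suffices. -/
theorem lintegral_graph_le (he : ‖e‖ = 1) (hψ : LipschitzWith L ψ)
    (hinv : ∀ y, ∀ t : ℝ, ψ (y + t • e) = ψ y) {m : EuclideanSpace ℝ (Fin d) → ℝ≥0∞}
    (hm : Measurable m) :
    ∫⁻ x in {x | inner ℝ e x = ψ x}, m x ∂(surf d) ≤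
      ((1 + L : ℝ≥0) : ℝ≥0∞) ^ (d - 1) * ∫⁻ y : (ℝ ∙ e)ᗮ, m (graphMap e ψ y) := by
  have hmeas : Measurable (graphMap e ψ) := (lipschitzWith_graphMap he hψ).continuous.measurable
  have hle : (surf d).restrict {x | inner ℝ e x = ψ x} ≤
      (((1 + L : ℝ≥0) : ℝ≥0∞) ^ (d - 1)) • Measure.map (graphMap e ψ) volume := by
    refine Measure.le_iff.2 fun A hA => ?_
    rw [Measure.restrict_apply hA, Measure.smul_apply, smul_eq_mul, Measure.map_apply hmeas hA]
    exact surf_inter_graph_le he hψ hinv A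
  refine (lintegral_mono' hle le_rfl).trans ?_
  rw [lintegral_smul_measure, lintegral_map hm hmeas, smul_eq_mul]

/-- The projection to the hyperplane is 1-Lipschitz, so the parameters of graph points in a ball lie
in a ball of the same radius in dimension d - 1. -/
theorem surf_graph_inter_closedBall_le (he : ‖e‖ = 1) (hψ : LipschitzWith L ψ)
    (hinv : ∀ y, ∀ t : ℝ, ψ (y + t • e) = ψ y) (x : EuclideanSpace ℝ (Fin d)) {r : ℝ} (hr : 0 ≤ r) :
    surf d (Metric.closedBall x r ∩ {x | inner ℝ e x = ψ x}) ≤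
      ((1 + L : ℝ≥0) : ℝ≥0∞) ^ (d - 1) * volume (Metric.closedBall (0 : (ℝ ∙ e)ᗮ) 1) *
        ENNReal.ofReal (r ^ (d - 1)) := by
  refine (surf_inter_graph_le he hψ hinv _).trans ?_
  rw [mul_assoc]
  gcongr
  rw [mul_comm, ← finrank_hyperplane he, ← Measure.addHaar_closedBall' volume (hyperProj e x) hr]
  refine measure_mono fun y hy => ?_
  rw [mem_preimage, Metric.mem_closedBall] at hy
  rw [Metric.mem_closedBall, ← hyperProj_graphMap (ψ := ψ) y]
  refine le_trans ?_ hy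
  have := (ℝ ∙ e)ᗮ.lipschitzWith_orthogonalProjectionOnto.dist_le_mul (graphMap e ψ y) x
  rwa [NNReal.coe_one, one_mul] at this

/-- Fubini in the orthogonal splitting into the line of `e` and its complement. -/
theorem volume_eq_lintegral_lines (he : ‖e‖ = 1) {S : Set (EuclideanSpace ℝ (Fin d))}
    (hS : MeasurableSet S) :
    volume S = ∫⁻ y : (ℝ ∙ e)ᗮ, volume {t : ℝ | (y : EuclideanSpace ℝ (Fin d)) + t • e ∈ S} := by
  have h1 := ((ℝ ∙ e).measurePreserving_measurableEquivProd (0 : EuclideanSpace ℝ (Fin d))).symm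
  have h2 : MeasurePreserving (LinearIsometryEquiv.toSpanUnitSingleton (𝕜 := ℝ) e he) :=
    LinearIsometryEquiv.measurePreserving _
  have h3 := h1.comp (h2.prod (MeasurePreserving.id (volume : Measure (ℝ ∙ e)ᗮ)))
  rw [InnerProductSpace.euclideanHausdorffMeasure_eq_volume] at h3
  rw [← h3.measure_preimage hS.nullMeasurableSet, Measure.prod_apply_symm (h3.measurable hS)]
  refine lintegral_congr fun y => ?_
  congr 1
  ext t
  simp [add_comm]

theorem measurable_volume_ray (e : EuclideanSpace ℝ (Fin d)) (s : ℝ)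
    {S : Set (EuclideanSpace ℝ (Fin d))} (hS : MeasurableSet S) :
    Measurable fun x : EuclideanSpace ℝ (Fin d) =>
      volume {t : ℝ | t ∈ Ioo 0 s ∧ x + t • e ∈ S} := by
  have hmeas : MeasurableSet {q : EuclideanSpace ℝ (Fin d) × ℝ |
      q.2 ∈ Ioo 0 s ∧ q.1 + q.2 • e ∈ S} := by
    refine (measurable_snd measurableSet_Ioo).inter ?_
    have : Continuous fun q : EuclideanSpace ℝ (Fin d) × ℝ => q.1 + q.2 • e := by fun_prop
    exact this.measurable hS
  exact measurable_measure_prodMk_left hmeas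

/-- Each ray is part of a line in direction `e`, and t ↦ ψ y + ε t preserves length. The sign ε
selects the side of the graph. -/
theorem lintegral_ray_le (he : ‖e‖ = 1) {ε : ℝ} (hε : ε = 1 ∨ ε = -1) (s : ℝ)
    {S : Set (EuclideanSpace ℝ (Fin d))} (hS : MeasurableSet S) :
    ∫⁻ y : (ℝ ∙ e)ᗮ, volume {t : ℝ | t ∈ Ioo 0 s ∧ graphMap e ψ y + t • (ε • e) ∈ S} ≤
      volume S := by
  rw [volume_eq_lintegral_lines he hS]
  refine lintegral_mono fun y => ?_
  have hmp : MeasurePreserving (fun t : ℝ => ψ y + ε * t) := by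
    rcases hε with rfl | rfl
    · simpa using measurePreserving_add_left volume (ψ y)
    · simpa [← sub_eq_add_neg] using Measure.measurePreserving_sub_left volume (ψ y)
  have hm : MeasurableSet {t : ℝ | (y : EuclideanSpace ℝ (Fin d)) + t • e ∈ S} := by
    have : Continuous fun t : ℝ => (y : EuclideanSpace ℝ (Fin d)) + t • e := by fun_prop
    exact this.measurable hS
  rw [← hmp.measure_preimage hm.nullMeasurableSet]
  refine measure_mono ?_
  rintro t ⟨-, ht⟩
  rw [mem_preimage, mem_ofPred_eq]
  convert ht using 1
  rw [graphMap, add_smul, smul_smul, mul_comm ε t, add_assoc]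

end LipschitzGraph

/-! ### Uniqueness of the outer normal and its value on a subgraph. -/

section Normal

variable {d : ℕ}

/-- Follow x + t v for small t > 0: the expansion with `ν` puts these points in `D`, and the
expansion with `ν'` then bounds ⟪ν', v⟫ by any ε > 0. -/
theorem IsOuterUnitNormal.inner_nonpos {D : Set (EuclideanSpace ℝ (Fin d))}
    {x ν ν' v : EuclideanSpace ℝ (Fin d)} (h : IsOuterUnitNormal D x ν)
    (h' : IsOuterUnitNormal D x ν') (hv : inner ℝ ν v < 0) : inner ℝ ν' v ≤ 0 := by
  have hvpos : 0 < ‖v‖ := by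
    rw [norm_pos_iff]
    rintro rfl
    simp at hv
  refine le_of_forall_pos_le_add fun ε hε => ?_
  have hlim : Tendsto (fun t : ℝ => x + t • v) (𝓝[>] 0) (𝓝 x) := by
    have : Continuous fun t : ℝ => x + t • v := by fun_prop
    have h0 := this.tendsto 0
    simp only [zero_smul, add_zero] at h0
    exact h0.mono_left nhdsWithin_le_nhds
  -- The tolerance is half the slope of ⟪ν, ·⟫ along v, so being outside `D` would contradict the
  -- sign of that slope.
  have e1 := hlim.eventually (h.2 (-(inner ℝ ν v) / (2 * ‖v‖)) (by
    have : 0 < -(inner ℝ ν v : ℝ) := by linarith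
    positivity))
  have e2 := hlim.eventually (h'.2 (ε / ‖v‖) (by positivity))
  obtain ⟨t, ⟨h1, h2⟩, ht⟩ := ((e1.and e2).and (eventually_mem_nhdsWithin (a := (0 : ℝ)))).exists
  rw [mem_Ioi] at ht
  simp only [add_sub_cancel_left, inner_smul_right, norm_smul, Real.norm_of_nonneg ht.le] at h1 h2
  have hmem : x + t • v ∈ D := by
    by_contra hcon
    have h3 := h1.2 hcon
    have h4 : -(inner ℝ ν v) / (2 * ‖v‖) * (t * ‖v‖) = -(inner ℝ ν v) * t / 2 := by
      field_simp
    rw [h4] at h3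
    nlinarith
  have h3 := h2.1 hmem
  have h4 : ε / ‖v‖ * (t * ‖v‖) = t * ε := by field_simp
  rw [h4] at h3
  rw [zero_add]
  exact le_of_mul_le_mul_left h3 ht

theorem IsOuterUnitNormal.unique {D : Set (EuclideanSpace ℝ (Fin d))}
    {x ν ν' : EuclideanSpace ℝ (Fin d)} (h : IsOuterUnitNormal D x ν)
    (h' : IsOuterUnitNormal D x ν') : ν = ν' := by
  by_contra hne
  have hc : inner ℝ ν ν' < 1 := (inner_lt_one_iff_real_of_norm_eq_one h.1 h'.1).2 hne
  -- The direction ν' - ν has negative product with ν but positive product with ν' when the two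
  -- differ.
  have h1 := h.inner_nonpos h' (v := ν' - ν) (by
    rw [inner_sub_right, real_inner_self_eq_norm_sq, h.1]
    linarith)
  rw [inner_sub_right, real_inner_self_eq_norm_sq, h'.1, real_inner_comm] at h1
  linarith

theorem IsOuterUnitNormal.outerNormal_eq {D : Set (EuclideanSpace ℝ (Fin d))}
    {x ν : EuclideanSpace ℝ (Fin d)} (h : IsOuterUnitNormal D x ν) : outerNormal D x = ν := by
  have hex : ∃ ν, IsOuterUnitNormal D x ν := ⟨ν, h⟩
  rw [outerNormal, dif_pos hex]
  exact hex.choose_spec.unique h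

theorem norm_outerNormal_le (D : Set (EuclideanSpace ℝ (Fin d))) (x : EuclideanSpace ℝ (Fin d)) :
    ‖outerNormal D x‖ ≤ 1 := by
  rw [outerNormal]
  split_ifs with h
  · exact h.choose_spec.1.le
  · simp

/-- The normal of a subgraph at a point of differentiability. -/
theorem outerNormal_subgraph {D : Set (EuclideanSpace ℝ (Fin d))} {e x : EuclideanSpace ℝ (Fin d)}
    {ψ : EuclideanSpace ℝ (Fin d) → ℝ} (he : ‖e‖ = 1)
    (hinv : ∀ y, ∀ t : ℝ, ψ (y + t • e) = ψ y) (hx : inner ℝ e x = ψ x)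
    (hD : ∀ᶠ y in 𝓝 x, (y ∈ D ↔ inner ℝ e y < ψ y)) (hψ : DifferentiableAt ℝ ψ x) :
    outerNormal D x = ‖e - gradient ψ x‖⁻¹ • (e - gradient ψ x) := by
  set w := e - gradient ψ x with hw
  -- Since ψ is constant along `e`, its gradient is orthogonal to `e`. Hence ⟪w, e⟫ = 1, and w can
  -- be normalized.
  have hge : inner ℝ (gradient ψ x) e = 0 := by
    have h1 : HasDerivAt (fun t : ℝ => ψ (x + t • e)) (inner ℝ (gradient ψ x) e) 0 := by
      have h2 := hψ.hasGradientAt.hasFDerivAt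
      have h3 : HasDerivAt (fun t : ℝ => x + t • e) e 0 := by
        simpa using ((hasDerivAt_id (0 : ℝ)).smul_const e).const_add x
      have h4 : HasFDerivAt ψ (InnerProductSpace.toDual ℝ _ (gradient ψ x)) (x + (0 : ℝ) • e) := by
        simpa using h2
      have := h4.comp_hasDerivAt (0 : ℝ) h3
      simpa [Function.comp_def] using this
    have h5 : (fun t : ℝ => ψ (x + t • e)) = fun _ => ψ x := funext fun t => hinv x t
    rw [h5] at h1
    exact h1.unique (hasDerivAt_const 0 (ψ x))
  have hwpos : 0 < ‖w‖ := by
    rw [norm_pos_iff]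
    intro h0
    have h1 : inner ℝ w e = 1 := by
      rw [hw, inner_sub_left, hge, real_inner_self_eq_norm_sq, he]
      norm_num
    rw [h0, inner_zero_left] at h1
    exact zero_ne_one h1
  refine IsOuterUnitNormal.outerNormal_eq ⟨?_, fun ε hε => ?_⟩
  · rw [norm_smul, norm_inv, norm_norm, inv_mul_cancel₀ hwpos.ne']
  have hlo := (hasGradientAt_iff_isLittleO.1 hψ.hasGradientAt).def (c := ε * ‖w‖) (by positivity)
  filter_upwards [hD, hlo] with y hy1 hy2
  rw [hy1, inner_smul_left]
  have h1 : (inner ℝ w (y - x) : ℝ) = inner ℝ e y - ψ x - inner ℝ (gradient ψ x) (y - x) := by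
    rw [hw, inner_sub_left, inner_sub_right e, hx]
  rw [Real.norm_eq_abs, abs_le] at hy2
  have h2 : ‖w‖ * (‖w‖⁻¹ * inner ℝ w (y - x)) = inner ℝ w (y - x) := by
    rw [← mul_assoc, mul_inv_cancel₀ hwpos.ne', one_mul]
  simp only [map_inv₀, conj_trivial]
  constructor
  · intro h3
    refine le_of_mul_le_mul_left ?_ hwpos
    rw [h2, h1]
    nlinarith
  · intro h3
    refine le_of_mul_le_mul_left ?_ hwpos
    rw [h2, h1]
    nlinarith

theorem measurable_gradient (ψ : EuclideanSpace ℝ (Fin d) → ℝ) : Measurable (gradient ψ) :=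
  (InnerProductSpace.toDual ℝ (EuclideanSpace ℝ (Fin d))).symm.continuous.measurable.comp
    (measurable_fderiv ℝ ψ)

end Normal

/-! ### Density of the interface, a trace estimate, and measurability of the normal. -/

namespace Geometry

open scoped ENNReal

variable {d : ℕ} (G : Geometry d)

theorem inner_eq_of_mem_Γ {e x : EuclideanSpace ℝ (Fin d)} {ψ : EuclideanSpace ℝ (Fin d) → ℝ}
    (hx : x ∈ G.Γ)
    (h : (x ∈ G.sub 0 ↔ inner ℝ e x < ψ x) ∧ (x ∈ G.sub 1 ↔ ψ x < inner ℝ e x)) :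
    inner ℝ e x = ψ x := by
  have h0 : ¬ inner ℝ e x < ψ x := fun hc => Set.disjoint_left.1 (G.disjoint_Γ_sub 0) hx (h.1.2 hc)
  have h1 : ¬ ψ x < inner ℝ e x := fun hc => Set.disjoint_left.1 (G.disjoint_Γ_sub 1) hx (h.2.2 hc)
  exact le_antisymm (not_lt.1 h1) (not_lt.1 h0)

/-- The interface has at most `(d-1)`-dimensional density. -/
theorem exists_surf_closedBall_le :
    ∃ C : ℝ≥0, ∀ (x : EuclideanSpace ℝ (Fin d)) (r : ℝ), 0 ≤ r →
      surf d (G.Γ ∩ Metric.closedBall x r) ≤ C * ENNReal.ofReal (r ^ (d - 1)) := by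
  suffices h : ∃ C : ℝ≥0, ∀ (x : EuclideanSpace ℝ (Fin d)) (r : ℝ), 0 ≤ r →
      surf d (G.Γ ∩ (G.Γ ∩ Metric.closedBall x r)) ≤ C * ENNReal.ofReal (r ^ (d - 1)) by
    simpa only [← inter_assoc, inter_self] using h
  -- The property passes to subsets and finite unions, so by compactness it suffices to have it in
  -- one chart around each point.
  refine G.isCompact_Γ.induction_on (p := fun A => ∃ C : ℝ≥0,
    ∀ (x : EuclideanSpace ℝ (Fin d)) (r : ℝ), 0 ≤ r →
      surf d (A ∩ (G.Γ ∩ Metric.closedBall x r)) ≤ C * ENNReal.ofReal (r ^ (d - 1)))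
    ?_ ?_ ?_ ?_
  · exact ⟨0, by simp⟩
  · rintro A B hAB ⟨C, hC⟩
    exact ⟨C, fun x r hr => (measure_mono (inter_subset_inter_left _ hAB)).trans (hC x r hr)⟩
  · rintro A B ⟨C, hC⟩ ⟨C', hC'⟩
    refine ⟨C + C', fun x r hr => ?_⟩
    rw [union_inter_distrib_right, ENNReal.coe_add, add_mul]
    exact (measure_union_le _ _).trans (add_le_add (hC x r hr) (hC' x r hr))
  · intro z hz
    obtain ⟨e, r₀, L, ψ, he, hr₀, hψ, hinv, hchart⟩ := G.lipschitz_interface z hz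
    refine ⟨Metric.ball z r₀, mem_nhdsWithin_of_mem_nhds (Metric.ball_mem_nhds z hr₀),
      (1 + L) ^ (d - 1) * (volume (Metric.closedBall (0 : (ℝ ∙ e)ᗮ) 1)).toNNReal, fun x r hr => ?_⟩
    rw [ENNReal.coe_mul, ENNReal.coe_pow,
      ENNReal.coe_toNNReal (measure_closedBall_lt_top.ne)]
    refine (measure_mono ?_).trans (surf_graph_inter_closedBall_le he hψ hinv x hr)
    rintro y ⟨hy1, hy2, hy3⟩
    exact ⟨hy3, G.inner_eq_of_mem_Γ hy2 (hchart y hy1)⟩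

theorem surf_Γ_lt_top : surf d G.Γ < ⊤ := by
  obtain ⟨C, hC⟩ := G.exists_surf_closedBall_le
  obtain ⟨R, hR⟩ := G.isCompact_Γ.isBounded.subset_closedBall 0
  have hR' : G.Γ ⊆ Metric.closedBall 0 (max R 0) :=
    hR.trans (Metric.closedBall_subset_closedBall (le_max_left _ _))
  have := hC 0 (max R 0) (le_max_right _ _)
  rw [inter_eq_left.2 hR'] at this
  exact this.trans_lt (ENNReal.mul_lt_top ENNReal.coe_lt_top ENNReal.ofReal_lt_top)

/-- A trace estimate: if `f` at each point of `Γ` is bounded by the length of the part in `S` of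
every ray that stays in `sub l` for a fixed length, then the integral of `f` over `Γ` is bounded by
the volume of `S`. -/
theorem exists_lintegral_le_volume (l : Fin 2) :
    ∃ C : ℝ≥0, ∃ s : ℝ, 0 < s ∧ ∀ (S : Set (EuclideanSpace ℝ (Fin d))), MeasurableSet S →
      ∀ f : EuclideanSpace ℝ (Fin d) → ℝ≥0∞,
        (∀ x ∈ G.Γ, ∀ e : EuclideanSpace ℝ (Fin d), ‖e‖ = 1 →
          (∀ t ∈ Ioo 0 s, x + t • e ∈ G.sub l) →
            f x ≤ volume {t : ℝ | t ∈ Ioo 0 s ∧ x + t • e ∈ S}) →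
        ∫⁻ x in G.Γ, f x ∂(surf d) ≤ C * volume S := by
  suffices h : ∃ C : ℝ≥0, ∃ s : ℝ, 0 < s ∧ ∀ (S : Set (EuclideanSpace ℝ (Fin d))), MeasurableSet S →
      ∀ f : EuclideanSpace ℝ (Fin d) → ℝ≥0∞,
        (∀ x ∈ G.Γ, ∀ e : EuclideanSpace ℝ (Fin d), ‖e‖ = 1 →
          (∀ t ∈ Ioo 0 s, x + t • e ∈ G.sub l) →
            f x ≤ volume {t : ℝ | t ∈ Ioo 0 s ∧ x + t • e ∈ S}) →
        ∫⁻ x in G.Γ ∩ G.Γ, f x ∂(surf d) ≤ C * volume S by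
    simpa only [inter_self] using h
  refine G.isCompact_Γ.induction_on (p := fun A => ∃ C : ℝ≥0, ∃ s : ℝ, 0 < s ∧
      ∀ (S : Set (EuclideanSpace ℝ (Fin d))), MeasurableSet S →
      ∀ f : EuclideanSpace ℝ (Fin d) → ℝ≥0∞,
        (∀ x ∈ G.Γ, ∀ e : EuclideanSpace ℝ (Fin d), ‖e‖ = 1 →
          (∀ t ∈ Ioo 0 s, x + t • e ∈ G.sub l) →
            f x ≤ volume {t : ℝ | t ∈ Ioo 0 s ∧ x + t • e ∈ S}) →
        ∫⁻ x in A ∩ G.Γ, f x ∂(surf d) ≤ C * volume S) ?_ ?_ ?_ ?_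
  · exact ⟨0, 1, one_pos, by simp⟩
  · rintro A B hAB ⟨C, s, hs, h⟩
    exact ⟨C, s, hs, fun S hS f hf =>
      (lintegral_mono_set (inter_subset_inter_left _ hAB)).trans (h S hS f hf)⟩
  · rintro A B ⟨C, s, hs, h⟩ ⟨C', s', hs', h'⟩
    -- A ray that stays in `G.sub l` for the longer length does so for the minimum too, and
    -- enlarging the length only enlarges the measured part. The hypothesis for the minimum
    -- therefore gives both original ones.
    refine ⟨C + C', min s s', lt_min hs hs', fun S hS f hf => ?_⟩
    rw [union_inter_distrib_right, ENNReal.coe_add, add_mul]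
    refine (lintegral_union_le _ _ _).trans (add_le_add (h S hS f ?_) (h' S hS f ?_))
    · intro x hx e he hsub
      refine (hf x hx e he fun t ht => hsub t ⟨ht.1, ht.2.trans_le (min_le_left _ _)⟩).trans ?_
      exact measure_mono fun t ht => ⟨⟨ht.1.1, ht.1.2.trans_le (min_le_left _ _)⟩, ht.2⟩
    · intro x hx e he hsub
      refine (hf x hx e he fun t ht => hsub t ⟨ht.1, ht.2.trans_le (min_le_right _ _)⟩).trans ?_
      exact measure_mono fun t ht => ⟨⟨ht.1.1, ht.1.2.trans_le (min_le_right _ _)⟩, ht.2⟩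
  · intro z hz
    obtain ⟨e, r, L, ψ, he, hr, hψ, hinv, hchart⟩ := G.lipschitz_interface z hz
    -- With half the chart radius for both the base points and the rays, every ray stays in the
    -- chart.
    refine ⟨Metric.ball z (r / 2),
      mem_nhdsWithin_of_mem_nhds (Metric.ball_mem_nhds z (by positivity)),
      (1 + L) ^ (d - 1), r / 2, by positivity, fun S hS f hf => ?_⟩
    -- `G.sub 0` lies below the graph and `G.sub 1` above it.
    let ε : ℝ := if l = 0 then -1 else 1
    have hε : ε = 1 ∨ ε = -1 := by
      simp only [ε]
      split_ifs <;> simp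
    have hee : (inner ℝ e e : ℝ) = 1 := by
      rw [real_inner_self_eq_norm_sq, he]
      norm_num
    have hnorm : ‖ε • e‖ = 1 := by
      rw [norm_smul, he, mul_one]
      rcases hε with h | h <;> rw [h] <;> simp
    have hgraph : ∀ x ∈ Metric.ball z (r / 2) ∩ G.Γ, inner ℝ e x = ψ x := fun x hx =>
      G.inner_eq_of_mem_Γ hx.2
        (hchart x (Metric.ball_subset_ball (by linarith) hx.1))
    have hray : ∀ x ∈ Metric.ball z (r / 2) ∩ G.Γ, ∀ t ∈ Ioo 0 (r / 2),
        x + t • (ε • e) ∈ G.sub l := by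
      intro x hx t ht
      have hball : x + t • (ε • e) ∈ Metric.ball z r := by
        rw [Metric.mem_ball]
        have h1 : dist (x + t • (ε • e)) x = t := by
          rw [dist_eq_norm, add_sub_cancel_left, norm_smul, hnorm, mul_one,
            Real.norm_of_nonneg ht.1.le]
        have h2 := dist_triangle (x + t • (ε • e)) x z
        have h3 := Metric.mem_ball.1 hx.1
        linarith [ht.2]
      have h1 : ψ (x + t • (ε • e)) = ψ x := by
        rw [smul_smul]
        exact hinv _ _
      have h2 : inner ℝ e (x + t • (ε • e)) = ψ x + t * ε := by
        rw [inner_add_right, hgraph x hx, inner_smul_right, inner_smul_right, hee, mul_one]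
      have h3 := hchart _ hball
      rw [h1, h2] at h3
      fin_cases l
      · refine h3.1.2 ?_
        have : ε = -1 := by simp [ε]
        rw [this]
        linarith [ht.1]
      · refine h3.2.2 ?_
        have : ε = 1 := by simp [ε]
        rw [this]
        linarith [ht.1]
    have hmeasA : MeasurableSet (Metric.ball z (r / 2) ∩ G.Γ) :=
      measurableSet_ball.inter G.measurableSet_Γ
    calc ∫⁻ x in Metric.ball z (r / 2) ∩ G.Γ, f x ∂(surf d)
        ≤ ∫⁻ x in Metric.ball z (r / 2) ∩ G.Γ,
            volume {t : ℝ | t ∈ Ioo 0 (r / 2) ∧ x + t • (ε • e) ∈ S} ∂(surf d) :=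
          setLIntegral_mono' hmeasA fun x hx => hf x hx.2 _ hnorm (hray x hx)
      _ ≤ ∫⁻ x in {x | inner ℝ e x = ψ x},
            volume {t : ℝ | t ∈ Ioo 0 (r / 2) ∧ x + t • (ε • e) ∈ S} ∂(surf d) :=
          lintegral_mono_set hgraph
      _ ≤ ((1 + L : ℝ≥0) : ℝ≥0∞) ^ (d - 1) * ∫⁻ y : (ℝ ∙ e)ᗮ,
            volume {t : ℝ | t ∈ Ioo 0 (r / 2) ∧ graphMap e ψ y + t • (ε • e) ∈ S} :=
          lintegral_graph_le he hψ hinv (measurable_volume_ray _ _ hS)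
      _ ≤ (((1 + L) ^ (d - 1) : ℝ≥0) : ℝ≥0∞) * volume S := by
          rw [ENNReal.coe_pow]
          gcongr
          exact lintegral_ray_le he hε _ hS

theorem norm_n_le (x : EuclideanSpace ℝ (Fin d)) : ‖G.n x‖ ≤ 1 := norm_outerNormal_le _ _

/-- The normal is defined pointwise by choice, so measurability must be read off from charts: by
Rademacher it is almost everywhere the normalized e - ∇ψ. This gives the integrability behind the
bilinearity of the consistency term. -/
theorem aestronglyMeasurable_n : AEStronglyMeasurable G.n ((surf d).restrict G.Γ) := by
  suffices h : AEStronglyMeasurable G.n ((surf d).restrict (G.Γ ∩ G.Γ)) by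
    simpa only [inter_self] using h
  refine G.isCompact_Γ.induction_on
    (p := fun A => AEStronglyMeasurable G.n ((surf d).restrict (A ∩ G.Γ))) ?_ ?_ ?_ ?_
  · simp
  · intro A B hAB h
    exact h.mono_set (inter_subset_inter_left _ hAB)
  · intro A B hA hB
    rw [union_inter_distrib_right]
    exact aestronglyMeasurable_union_iff.2 ⟨hA, hB⟩
  · intro z hz
    obtain ⟨e, r, L, ψ, he, hr, hψ, hinv, hchart⟩ := G.lipschitz_interface z hz
    refine ⟨Metric.ball z r, mem_nhdsWithin_of_mem_nhds (Metric.ball_mem_nhds z hr), ?_⟩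
    have hmeas : Measurable fun x => ‖e - gradient ψ x‖⁻¹ • (e - gradient ψ x) :=
      ((measurable_const.sub (measurable_gradient ψ)).norm.inv).smul
        (measurable_const.sub (measurable_gradient ψ))
    have hmeasA : MeasurableSet (Metric.ball z r ∩ G.Γ) :=
      measurableSet_ball.inter G.measurableSet_Γ
    have hnull : surf d ({x | ¬ DifferentiableAt ℝ ψ x} ∩ {x | inner ℝ e x = ψ x}) = 0 := by
      refine le_antisymm ((surf_inter_graph_le he hψ hinv _).trans ?_) bot_le
      -- Rademacher's theorem in the ambient space says nothing about the graph, which is a null set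
      -- there. It is applied on the hyperplane, and the null set is carried to the graph by the
      -- Lipschitz parametrization.
      have hae : ∀ᵐ y : (ℝ ∙ e)ᗮ, DifferentiableAt ℝ (fun y : (ℝ ∙ e)ᗮ => ψ y) y := by
        have hL : LipschitzWith (L * 1) (fun y : (ℝ ∙ e)ᗮ => ψ y) :=
          hψ.comp (LipschitzWith.subtype_val _)
        exact hL.ae_differentiableAt
      have h0 : volume (graphMap e ψ ⁻¹' {x | ¬ DifferentiableAt ℝ ψ x}) = 0 := by
        refine measure_mono_null ?_ (ae_iff.1 hae)
        intro y hy hcon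
        refine hy ?_
        have h1 : ψ = (fun y : (ℝ ∙ e)ᗮ => ψ y) ∘ hyperProj e :=
          funext fun x => eq_comp_hyperProj he hinv x
        rw [h1]
        refine DifferentiableAt.comp _ ?_ (hyperProj e).differentiableAt
        rwa [hyperProj_graphMap]
      rw [h0, mul_zero]
    refine ⟨_, hmeas.stronglyMeasurable, ?_⟩
    have h1 : ∀ᵐ x ∂((surf d).restrict (Metric.ball z r ∩ G.Γ)),
        ¬ (x ∈ {x | ¬ DifferentiableAt ℝ ψ x} ∩ {x | inner ℝ e x = ψ x}) :=
      ae_restrict_of_ae (measure_eq_zero_iff_ae_notMem.1 hnull)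
    filter_upwards [h1, ae_restrict_mem hmeasA] with x hx1 hx2
    have hgr := G.inner_eq_of_mem_Γ hx2.2 (hchart x hx2.1)
    have hdiff : DifferentiableAt ℝ ψ x := by
      by_contra hcon
      exact hx1 ⟨hcon, hgr⟩
    refine outerNormal_subgraph he hinv hgr ?_ hdiff
    filter_upwards [Metric.isOpen_ball.mem_nhds hx2.1] with y hy using (hchart y hy).1

end Geometry

theorem sum_fin_two_eq {M : Type*} [AddCommMonoid M] (l : Fin 2) (f : Fin 2 → M) :
    ∑ i, f i = f l + f (1 - l) := by
  rw [Fin.sum_univ_two]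
  fin_cases l
  · rfl
  · exact add_comm _ _

/-- The sign of the jump of a function that vanishes outside `sub l`. -/
def sgn (l : Fin 2) : ℝ := if l = 0 then 1 else -1

theorem sgn_mul_self (l : Fin 2) : sgn l * sgn l = 1 := by
  rw [sgn]
  split_ifs <;> norm_num

theorem abs_sgn (l : Fin 2) : |sgn l| = 1 := by
  rw [sgn]
  split_ifs <;> norm_num

/-! ### The Nitsche form and the energy in terms of coefficients. -/

namespace Triangulation

variable {d : ℕ} {G : Geometry d} (𝒯 : Triangulation G.Ω) {σ μ : ℝ} {l : Fin 2}
  {T : Finset (EuclideanSpace ℝ (Fin d))}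

section SplitIntegral

variable {ν : Measure (EuclideanSpace ℝ (Fin d))} {A : Set (EuclideanSpace ℝ (Fin d))}
  {F : EuclideanSpace ℝ (Fin d) → ℝ}

theorem inter_simplex_ae_eq (hnull : ν (A ∩ frontier (simplex T)) = 0) :
    (A ∩ simplex T : Set (EuclideanSpace ℝ (Fin d))) =ᵐ[ν]
      (A ∩ interior (simplex T) : Set (EuclideanSpace ℝ (Fin d))) := by
  refine Filter.EventuallyLE.antisymm ?_ ?_
  · rw [ae_le_set]
    refine measure_mono_null ?_ hnull
    rintro x ⟨⟨hxA, hxT⟩, hx⟩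
    refine ⟨hxA, ?_⟩
    rw [isClosed_simplex.frontier_eq]
    exact ⟨hxT, fun h => hx ⟨hxA, h⟩⟩
  · exact (inter_subset_inter_right _ interior_subset).eventuallyLE

/-- The measure is left general: the lemma serves volume on a subdomain and surface measure on the
interface, where the null hypothesis is `face_null`. -/
theorem ae_eq_iUnion_inter_interior (hAΩ : A ⊆ G.Ω)
    (hnull : ∀ T ∈ 𝒯.elems, ν (A ∩ frontier (simplex T)) = 0) :
    A =ᵐ[ν] (⋃ T ∈ 𝒯.elems, A ∩ interior (simplex T) : Set (EuclideanSpace ℝ (Fin d))) := by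
  refine Filter.EventuallyLE.antisymm ?_ ?_
  · rw [ae_le_set]
    refine measure_mono_null (t := ⋃ T ∈ (𝒯.elems : Set (Finset (EuclideanSpace ℝ (Fin d)))),
      A ∩ frontier (simplex T)) ?_
      ((measure_biUnion_null_iff 𝒯.elems.finite_toSet.countable).2 hnull)
    rintro x ⟨hxA, hx⟩
    obtain ⟨T, hT, hxT⟩ := 𝒯.exists_mem_simplex (hAΩ hxA)
    refine Set.mem_biUnion hT ⟨hxA, ?_⟩
    rw [isClosed_simplex.frontier_eq]
    exact ⟨hxT, fun h => hx (Set.mem_biUnion hT ⟨hxA, h⟩)⟩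
  · have hsub : (⋃ T ∈ 𝒯.elems, A ∩ interior (simplex T)) ⊆ A :=
      Set.iUnion₂_subset fun T _ => inter_subset_left
    exact hsub.eventuallyLE

theorem integrableOn_of_interior (hAΩ : A ⊆ G.Ω)
    (hnull : ∀ T ∈ 𝒯.elems, ν (A ∩ frontier (simplex T)) = 0)
    (hF : ∀ T ∈ 𝒯.elems, IntegrableOn F (A ∩ interior (simplex T)) ν) : IntegrableOn F A ν :=
  (integrableOn_congr_set_ae (𝒯.ae_eq_iUnion_inter_interior hAΩ hnull)).2
    (integrableOn_finset_iUnion.2 hF)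

theorem setIntegral_eq_sum (hA : MeasurableSet A) (hAΩ : A ⊆ G.Ω)
    (hnull : ∀ T ∈ 𝒯.elems, ν (A ∩ frontier (simplex T)) = 0)
    (hF : ∀ T ∈ 𝒯.elems, IntegrableOn F (A ∩ interior (simplex T)) ν) :
    ∫ x in A, F x ∂ν = ∑ T ∈ 𝒯.elems, ∫ x in A ∩ interior (simplex T), F x ∂ν := by
  rw [setIntegral_congr_set (𝒯.ae_eq_iUnion_inter_interior hAΩ hnull)]
  refine integral_biUnion_finset _ (fun T _ => hA.inter isOpen_interior.measurableSet) ?_ hF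
  intro T hT T' hT' hne
  exact (𝒯.disjoint_interior_simplex hT hT' hne).mono inter_subset_right
    (inter_subset_right.trans interior_subset)

end SplitIntegral

/-- The element of `W l` with coefficients `a`. -/
def comb (l : Fin 2) (a : EuclideanSpace ℝ (Fin d) → ℝ) : EuclideanSpace ℝ (Fin d) → ℝ :=
  ∑ p ∈ 𝒯.J l, a p • 𝒯.xhat p

/-- The affine function that agrees with `comb l a` on the part of `T` in `sub l`. -/
def pw (l : Fin 2) (T : Finset (EuclideanSpace ℝ (Fin d))) (a : EuclideanSpace ℝ (Fin d) → ℝ)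
    (x : EuclideanSpace ℝ (Fin d)) : ℝ :=
  ∑ p ∈ 𝒯.J l, a p * bary T p x

/-- The gradient of `pw l T a`. -/
def pwGrad (l : Fin 2) (T : Finset (EuclideanSpace ℝ (Fin d)))
    (a : EuclideanSpace ℝ (Fin d) → ℝ) : EuclideanSpace ℝ (Fin d) :=
  ∑ p ∈ 𝒯.J l, a p • baryGrad T p

theorem xhat_eq_hat {p x : EuclideanSpace ℝ (Fin d)} (hp : p ∈ G.sub (1 - l)) (hx : x ∈ G.sub l) :
    𝒯.xhat p x = 𝒯.hat p x := by
  have h := G.disjoint_sub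
  rw [Set.disjoint_left] at h
  fin_cases l
  · have hx' : x ∉ G.sub 1 := h hx
    have hp' : p ∈ G.sub 1 := hp
    simp [xhat, heaviside, hx', hp']
  · have hx' : x ∈ G.sub 1 := hx
    have hp' : p ∉ G.sub 1 := h hp
    simp [xhat, heaviside, hx', hp']

theorem xhat_eq_zero {p x : EuclideanSpace ℝ (Fin d)} (hp : p ∈ G.sub (1 - l))
    (hx : x ∈ G.sub (1 - l)) : 𝒯.xhat p x = 0 := by
  have h := G.disjoint_sub
  rw [Set.disjoint_left] at h
  fin_cases l
  · have hx' : x ∈ G.sub 1 := hx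
    have hp' : p ∈ G.sub 1 := hp
    simp [xhat, heaviside, hx', hp']
  · have hx' : x ∉ G.sub 1 := h hx
    have hp' : p ∉ G.sub 1 := h hp
    simp [xhat, heaviside, hx', hp']

theorem comb_apply (a : EuclideanSpace ℝ (Fin d) → ℝ) (x : EuclideanSpace ℝ (Fin d)) :
    𝒯.comb l a x = ∑ p ∈ 𝒯.J l, a p * 𝒯.xhat p x := by
  simp [comb, Finset.sum_apply]

theorem comb_eq_pw (hT : T ∈ 𝒯.elems) (a : EuclideanSpace ℝ (Fin d) → ℝ)
    {x : EuclideanSpace ℝ (Fin d)} (hxT : x ∈ simplex T) (hx : x ∈ G.sub l) :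
    𝒯.comb l a x = 𝒯.pw l T a x := by
  rw [comb_apply, pw]
  refine Finset.sum_congr rfl fun p hp => ?_
  rw [𝒯.xhat_eq_hat (J_subset_sub hp) hx, 𝒯.hat_eq_bary hT hxT]

theorem comb_eq_zero (a : EuclideanSpace ℝ (Fin d) → ℝ) {x : EuclideanSpace ℝ (Fin d)}
    (hx : x ∈ G.sub (1 - l)) : 𝒯.comb l a x = 0 := by
  rw [comb_apply]
  exact Finset.sum_eq_zero fun p hp => by rw [𝒯.xhat_eq_zero (J_subset_sub hp) hx, mul_zero]

theorem pw_sub (hT : T ∈ 𝒯.elems) (a : EuclideanSpace ℝ (Fin d) → ℝ)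
    (x y : EuclideanSpace ℝ (Fin d)) :
    𝒯.pw l T a x - 𝒯.pw l T a y = inner ℝ (𝒯.pwGrad l T a) (x - y) := by
  rw [pw, pw, pwGrad, sum_inner, ← Finset.sum_sub_distrib]
  refine Finset.sum_congr rfl fun p _ => ?_
  rw [← mul_sub, (𝒯.isBary hT).sub_eq, inner_smul_left]
  rfl

theorem continuous_pw (hT : T ∈ 𝒯.elems) (a : EuclideanSpace ℝ (Fin d) → ℝ) :
    Continuous (𝒯.pw l T a) :=
  continuous_finsetSum _ fun p _ => continuous_const.mul ((𝒯.isBary hT).continuous p)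

theorem hasGradientAt_pw (hT : T ∈ 𝒯.elems) (a : EuclideanSpace ℝ (Fin d) → ℝ)
    (x : EuclideanSpace ℝ (Fin d)) : HasGradientAt (𝒯.pw l T a) (𝒯.pwGrad l T a) x := by
  rw [hasGradientAt_iff_isLittleO]
  have : (fun y => 𝒯.pw l T a y - 𝒯.pw l T a x - inner ℝ (𝒯.pwGrad l T a) (y - x)) = fun _ => 0 :=
    funext fun y => by rw [𝒯.pw_sub hT, sub_self]
  rw [this]
  exact Asymptotics.isLittleO_zero _ _

theorem gradient_comb (hT : T ∈ 𝒯.elems) (a : EuclideanSpace ℝ (Fin d) → ℝ)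
    {x : EuclideanSpace ℝ (Fin d)} (hxT : x ∈ interior (simplex T)) (hx : x ∈ G.sub l) :
    gradient (𝒯.comb l a) x = 𝒯.pwGrad l T a := by
  refine HasGradientAt.gradient ((𝒯.hasGradientAt_pw hT a x).congr_of_eventuallyEq ?_)
  filter_upwards [isOpen_interior.mem_nhds hxT, (G.isOpen_sub l).mem_nhds hx] with y hy hy'
  exact 𝒯.comb_eq_pw hT a (interior_subset hy) hy'

theorem gradient_comb_eq_zero (a : EuclideanSpace ℝ (Fin d) → ℝ)
    {x : EuclideanSpace ℝ (Fin d)} (hx : x ∈ G.sub (1 - l)) : gradient (𝒯.comb l a) x = 0 := by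
  refine HasGradientAt.gradient ((hasGradientAt_const x (0 : ℝ)).congr_of_eventuallyEq ?_)
  filter_upwards [(G.isOpen_sub (1 - l)).mem_nhds hx] with y hy
  exact 𝒯.comb_eq_zero a hy

section Trace

variable {x : EuclideanSpace ℝ (Fin d)}

/-- Near a point of the interface inside an element, the function is affine on the `G.sub l` side,
so the one-sided limit exists. By `face_null` such points are almost all of the interface. -/
theorem trace_comb (hT : T ∈ 𝒯.elems) (a : EuclideanSpace ℝ (Fin d) → ℝ)
    (hx : x ∈ G.Γ ∩ interior (simplex T)) : trace G l (𝒯.comb l a) x = 𝒯.pw l T a x := by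
  have := G.neBot_nhdsWithin_sub l hx.1
  refine Tendsto.limUnder_eq ?_
  refine (((𝒯.continuous_pw hT a).tendsto x).mono_left nhdsWithin_le_nhds).congr' ?_
  filter_upwards [mem_nhdsWithin_of_mem_nhds (isOpen_interior.mem_nhds hx.2),
    self_mem_nhdsWithin] with y hy hy'
  exact (𝒯.comb_eq_pw hT a (interior_subset hy) hy').symm

theorem trace_comb_other (a : EuclideanSpace ℝ (Fin d) → ℝ) (hx : x ∈ G.Γ) :
    trace G (1 - l) (𝒯.comb l a) x = 0 := by
  have := G.neBot_nhdsWithin_sub (1 - l) hx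
  refine Tendsto.limUnder_eq (tendsto_const_nhds.congr' ?_)
  filter_upwards [self_mem_nhdsWithin] with y hy
  exact (𝒯.comb_eq_zero a hy).symm

theorem gradTrace_comb (hT : T ∈ 𝒯.elems) (a : EuclideanSpace ℝ (Fin d) → ℝ)
    (hx : x ∈ G.Γ ∩ interior (simplex T)) : gradTrace G l (𝒯.comb l a) x = 𝒯.pwGrad l T a := by
  have := G.neBot_nhdsWithin_sub l hx.1
  refine Tendsto.limUnder_eq (tendsto_const_nhds.congr' ?_)
  filter_upwards [mem_nhdsWithin_of_mem_nhds (isOpen_interior.mem_nhds hx.2),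
    self_mem_nhdsWithin] with y hy hy'
  exact (𝒯.gradient_comb hT a hy hy').symm

theorem gradTrace_comb_other (a : EuclideanSpace ℝ (Fin d) → ℝ) (hx : x ∈ G.Γ) :
    gradTrace G (1 - l) (𝒯.comb l a) x = 0 := by
  have := G.neBot_nhdsWithin_sub (1 - l) hx
  refine Tendsto.limUnder_eq (tendsto_const_nhds.congr' ?_)
  filter_upwards [self_mem_nhdsWithin] with y hy
  exact (𝒯.gradient_comb_eq_zero a hy).symm

theorem jump_comb (hT : T ∈ 𝒯.elems) (a : EuclideanSpace ℝ (Fin d) → ℝ)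
    (hx : x ∈ G.Γ ∩ interior (simplex T)) :
    jump G (𝒯.comb l a) x = sgn l * 𝒯.pw l T a x := by
  have h1 := 𝒯.trace_comb (l := l) hT a hx
  have h2 := 𝒯.trace_comb_other (l := l) a hx.1
  rw [jump, sgn]
  fin_cases l
  · have h2' : trace G 1 (𝒯.comb 0 a) x = 0 := h2
    have h1' : trace G 0 (𝒯.comb 0 a) x = 𝒯.pw 0 T a x := h1
    simp [h1', h2']
  · have h2' : trace G 0 (𝒯.comb 1 a) x = 0 := h2
    have h1' : trace G 1 (𝒯.comb 1 a) x = 𝒯.pw 1 T a x := h1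
    simp [h1', h2']

/-- The fraction of the volume of `T` that lies in `sub l`. -/
def κ (G : Geometry d) (l : Fin 2) (T : Finset (EuclideanSpace ℝ (Fin d))) : ℝ :=
  volume.real (simplex T ∩ G.sub l) / volume.real (simplex T)

theorem average_comb (α : Fin 2 → ℝ) (hT : T ∈ 𝒯.elems) (a : EuclideanSpace ℝ (Fin d) → ℝ)
    (hx : x ∈ G.Γ ∩ interior (simplex T)) :
    average G α T (𝒯.comb l a) x = α l * (κ G l T * inner ℝ (𝒯.pwGrad l T a) (G.n x)) := by
  rw [average, sum_fin_two_eq l, 𝒯.gradTrace_comb hT a hx, 𝒯.gradTrace_comb_other a hx.1,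
    inner_zero_left, mul_zero, mul_zero, add_zero, κ]
  ring

end Trace

/-- The gradient part of the energy product, in terms of coefficients. -/
def gradForm (l : Fin 2) (a b : EuclideanSpace ℝ (Fin d) → ℝ) : ℝ :=
  ∑ T ∈ 𝒯.elems, volume.real (simplex T ∩ G.sub l) * inner ℝ (𝒯.pwGrad l T a) (𝒯.pwGrad l T b)

/-- The `L²(Γ)` product of the jumps, in terms of coefficients. -/
def jumpInt (l : Fin 2) (a b : EuclideanSpace ℝ (Fin d) → ℝ) : ℝ :=
  ∑ T ∈ 𝒯.elems, ∫ x in G.Γ ∩ interior (simplex T), 𝒯.pw l T a x * 𝒯.pw l T b x ∂(surf d)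

/-- The consistency term for `α = 1`, in terms of coefficients. -/
def consInt (l : Fin 2) (a b : EuclideanSpace ℝ (Fin d) → ℝ) : ℝ :=
  sgn l * ∑ T ∈ 𝒯.elems, κ G l T *
    ∫ x in G.Γ ∩ interior (simplex T), inner ℝ (𝒯.pwGrad l T a) (G.n x) * 𝒯.pw l T b x ∂(surf d)

theorem abs_pw_le (hT : T ∈ 𝒯.elems) (a : EuclideanSpace ℝ (Fin d) → ℝ)
    {x : EuclideanSpace ℝ (Fin d)} (hx : x ∈ simplex T) :
    |𝒯.pw l T a x| ≤ ∑ p ∈ 𝒯.J l, |a p| := by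
  refine (Finset.abs_sum_le_sum_abs _ _).trans (Finset.sum_le_sum fun p _ => ?_)
  rw [abs_mul, abs_of_nonneg (((𝒯.isBary hT).mem_simplex_iff x).1 hx p)]
  exact mul_le_of_le_one_right (abs_nonneg _) ((𝒯.isBary hT).le_one hx)

theorem measurableSet_piece : MeasurableSet (G.Γ ∩ interior (simplex T)) :=
  G.measurableSet_Γ.inter isOpen_interior.measurableSet

theorem surf_piece_lt_top : surf d (G.Γ ∩ interior (simplex T)) < ⊤ :=
  (measure_mono inter_subset_left).trans_lt G.surf_Γ_lt_top

theorem integrableOn_pw_mul_pw (hT : T ∈ 𝒯.elems) (a b : EuclideanSpace ℝ (Fin d) → ℝ) :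
    IntegrableOn (fun x => 𝒯.pw l T a x * 𝒯.pw l T b x) (G.Γ ∩ interior (simplex T)) (surf d) := by
  refine Measure.integrableOn_of_bounded (M := (∑ p ∈ 𝒯.J l, |a p|) * ∑ p ∈ 𝒯.J l, |b p|)
    surf_piece_lt_top.ne
    ((𝒯.continuous_pw hT a).mul (𝒯.continuous_pw hT b)).aestronglyMeasurable ?_
  filter_upwards [ae_restrict_mem measurableSet_piece] with x hx
  rw [Real.norm_eq_abs, abs_mul]
  exact mul_le_mul (𝒯.abs_pw_le hT a (interior_subset hx.2))
    (𝒯.abs_pw_le hT b (interior_subset hx.2)) (abs_nonneg _)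
    (Finset.sum_nonneg fun _ _ => abs_nonneg _)

theorem integrableOn_inner_mul_pw (hT : T ∈ 𝒯.elems) (v : EuclideanSpace ℝ (Fin d))
    (b : EuclideanSpace ℝ (Fin d) → ℝ) :
    IntegrableOn (fun x => inner ℝ v (G.n x) * 𝒯.pw l T b x)
      (G.Γ ∩ interior (simplex T)) (surf d) := by
  have hfin : IsFiniteMeasure ((surf d).restrict (G.Γ ∩ interior (simplex T))) :=
    ⟨by rw [Measure.restrict_apply_univ]; exact surf_piece_lt_top⟩
  refine Integrable.of_bound ?_ (‖v‖ * ∑ p ∈ 𝒯.J l, |b p|) ?_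
  · have h1 : AEStronglyMeasurable G.n ((surf d).restrict (G.Γ ∩ interior (simplex T))) :=
      G.aestronglyMeasurable_n.mono_set inter_subset_left
    exact (aestronglyMeasurable_const.inner h1).mul (𝒯.continuous_pw hT b).aestronglyMeasurable
  filter_upwards [ae_restrict_mem measurableSet_piece] with x hx
  rw [Real.norm_eq_abs, abs_mul]
  refine mul_le_mul ?_ (𝒯.abs_pw_le hT b (interior_subset hx.2)) (abs_nonneg _) (norm_nonneg _)
  refine (abs_real_inner_le_norm _ _).trans ?_
  exact mul_le_of_le_one_right (norm_nonneg _) (G.norm_n_le x)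

theorem sum_integral_gradient (α : Fin 2 → ℝ) (a b : EuclideanSpace ℝ (Fin d) → ℝ) :
    ∑ i, α i * ∫ x in G.sub i, inner ℝ (gradient (𝒯.comb l a) x) (gradient (𝒯.comb l b) x) =
      α l * 𝒯.gradForm l a b := by
  have hother : ∫ x in G.sub (1 - l),
      (inner ℝ (gradient (𝒯.comb l a) x) (gradient (𝒯.comb l b) x) : ℝ) = 0 := by
    refine setIntegral_eq_zero_of_forall_eq_zero fun x hx => ?_
    rw [𝒯.gradient_comb_eq_zero a hx, inner_zero_left]
  have hnull : ∀ T ∈ 𝒯.elems, volume (G.sub l ∩ frontier (simplex T)) = 0 := fun T _ =>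
    measure_mono_null inter_subset_right volume_frontier_simplex
  have hmeas : ∀ T : Finset (EuclideanSpace ℝ (Fin d)),
      MeasurableSet (G.sub l ∩ interior (simplex T)) := fun T =>
    (G.isOpen_sub l).measurableSet.inter isOpen_interior.measurableSet
  have heq : ∀ T ∈ 𝒯.elems, EqOn
      (fun x => (inner ℝ (gradient (𝒯.comb l a) x) (gradient (𝒯.comb l b) x) : ℝ))
      (fun _ => inner ℝ (𝒯.pwGrad l T a) (𝒯.pwGrad l T b)) (G.sub l ∩ interior (simplex T)) := by
    intro T hT x hx
    simp only [𝒯.gradient_comb hT _ hx.2 hx.1]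
  rw [sum_fin_two_eq l, hother, mul_zero, add_zero,
    𝒯.setIntegral_eq_sum (G.isOpen_sub l).measurableSet (G.sub_subset l) hnull, gradForm]
  · congr 1
    refine Finset.sum_congr rfl fun T hT => ?_
    rw [setIntegral_congr_fun (hmeas T) (heq T hT), setIntegral_const, smul_eq_mul,
      measureReal_congr (inter_simplex_ae_eq (hnull T hT)).symm, inter_comm]
  · intro T hT
    refine IntegrableOn.congr_fun ?_ (heq T hT).symm (hmeas T)
    refine integrableOn_const ?_
    exact ((measure_mono (inter_subset_right.trans interior_subset)).trans_lt
      volume_simplex_lt_top).ne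

variable {𝒯}

theorem Admissible.jumpForm_comb (hA : 𝒯.Admissible σ μ) (a b : EuclideanSpace ℝ (Fin d) → ℝ) :
    jumpForm 𝒯 (𝒯.comb l a) (𝒯.comb l b) = 𝒯.h⁻¹ * 𝒯.jumpInt l a b := by
  have heq : ∀ T ∈ 𝒯.elems, EqOn (fun x => jump G (𝒯.comb l a) x * jump G (𝒯.comb l b) x)
      (fun x => 𝒯.pw l T a x * 𝒯.pw l T b x) (G.Γ ∩ interior (simplex T)) := by
    intro T hT x hx
    simp only [𝒯.jump_comb hT _ hx]
    rw [mul_mul_mul_comm, sgn_mul_self, one_mul]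
  rw [jumpForm, jumpInt, 𝒯.setIntegral_eq_sum G.measurableSet_Γ G.Γ_subset hA.face_null]
  · congr 1
    exact Finset.sum_congr rfl fun T hT => setIntegral_congr_fun measurableSet_piece (heq T hT)
  · intro T hT
    exact (𝒯.integrableOn_pw_mul_pw hT a b).congr_fun (heq T hT).symm measurableSet_piece

theorem Admissible.consistency_comb (hA : 𝒯.Admissible σ μ) (α : Fin 2 → ℝ)
    (a b : EuclideanSpace ℝ (Fin d) → ℝ) :
    consistency 𝒯 α (𝒯.comb l a) (𝒯.comb l b) = α l * 𝒯.consInt l a b := by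
  rw [consistency, consInt, Finset.mul_sum, Finset.mul_sum]
  refine Finset.sum_congr rfl fun T hT => ?_
  rw [setIntegral_congr_set (inter_simplex_ae_eq (hA.face_null T hT)),
    ← integral_const_mul, ← integral_const_mul, ← integral_const_mul]
  refine setIntegral_congr_fun measurableSet_piece fun x hx => ?_
  simp only [𝒯.jump_comb hT _ hx, 𝒯.average_comb α hT _ hx]
  ring

/-- Only one side contributes, so `α l` is the only coefficient left, and the form becomes a finite
sum over elements of integrals of affine data. -/
theorem Admissible.nitsche_comb (hA : 𝒯.Admissible σ μ) (α : Fin 2 → ℝ) (lam : ℝ)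
    (a b : EuclideanSpace ℝ (Fin d) → ℝ) :
    nitsche 𝒯 α lam (𝒯.comb l a) (𝒯.comb l b) = α l * 𝒯.gradForm l a b
      - α l * 𝒯.consInt l a b - α l * 𝒯.consInt l b a + lam * (𝒯.h⁻¹ * 𝒯.jumpInt l a b) := by
  rw [nitsche, sum_integral_gradient, hA.consistency_comb, hA.consistency_comb, hA.jumpForm_comb]

theorem Admissible.energySq_comb (hA : 𝒯.Admissible σ μ) (lam : ℝ)
    (a : EuclideanSpace ℝ (Fin d) → ℝ) :
    energySq 𝒯 lam (𝒯.comb l a) = 𝒯.gradForm l a a + lam * (𝒯.h⁻¹ * 𝒯.jumpInt l a a) := by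
  have := 𝒯.sum_integral_gradient (l := l) (fun _ => 1) a a
  simp only [one_mul, real_inner_self_eq_norm_sq] at this
  rw [energySq, this, hA.jumpForm_comb]

variable (𝒯)

/-! ### Bilinearity in the coefficients. -/

section Bilinear

variable (a a' b : EuclideanSpace ℝ (Fin d) → ℝ) (c : ℝ)

theorem pw_add (x : EuclideanSpace ℝ (Fin d)) :
    𝒯.pw l T (a + a') x = 𝒯.pw l T a x + 𝒯.pw l T a' x := by
  simp [pw, add_mul, Finset.sum_add_distrib]

theorem pw_smul (x : EuclideanSpace ℝ (Fin d)) : 𝒯.pw l T (c • a) x = c * 𝒯.pw l T a x := by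
  simp [pw, mul_assoc, Finset.mul_sum]

theorem pwGrad_add : 𝒯.pwGrad l T (a + a') = 𝒯.pwGrad l T a + 𝒯.pwGrad l T a' := by
  simp [pwGrad, add_smul, Finset.sum_add_distrib]

theorem pwGrad_smul : 𝒯.pwGrad l T (c • a) = c • 𝒯.pwGrad l T a := by
  simp [pwGrad, mul_smul, Finset.smul_sum]

theorem comb_add : 𝒯.comb l (a + a') = 𝒯.comb l a + 𝒯.comb l a' := by
  simp [comb, add_smul, Finset.sum_add_distrib]

theorem comb_smul : 𝒯.comb l (c • a) = c • 𝒯.comb l a := by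
  simp [comb, mul_smul, Finset.smul_sum]

theorem gradForm_add : 𝒯.gradForm l (a + a') b = 𝒯.gradForm l a b + 𝒯.gradForm l a' b := by
  simp only [gradForm, pwGrad_add, inner_add_left, mul_add, Finset.sum_add_distrib]

theorem gradForm_smul : 𝒯.gradForm l (c • a) b = c * 𝒯.gradForm l a b := by
  simp only [gradForm, pwGrad_smul, real_inner_smul_left, Finset.mul_sum]
  exact Finset.sum_congr rfl fun T _ => by ring

theorem jumpInt_add : 𝒯.jumpInt l (a + a') b = 𝒯.jumpInt l a b + 𝒯.jumpInt l a' b := by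
  simp only [jumpInt, ← Finset.sum_add_distrib]
  refine Finset.sum_congr rfl fun T hT => ?_
  rw [← integral_add (𝒯.integrableOn_pw_mul_pw hT a b) (𝒯.integrableOn_pw_mul_pw hT a' b)]
  simp only [pw_add, add_mul]

theorem jumpInt_smul : 𝒯.jumpInt l (c • a) b = c * 𝒯.jumpInt l a b := by
  simp only [jumpInt, Finset.mul_sum]
  refine Finset.sum_congr rfl fun T hT => ?_
  rw [← integral_const_mul]
  simp only [pw_smul, mul_assoc]

theorem consInt_add_left : 𝒯.consInt l (a + a') b = 𝒯.consInt l a b + 𝒯.consInt l a' b := by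
  simp only [consInt, ← mul_add, ← Finset.sum_add_distrib]
  congr 1
  refine Finset.sum_congr rfl fun T hT => ?_
  rw [← integral_add (𝒯.integrableOn_inner_mul_pw hT _ b) (𝒯.integrableOn_inner_mul_pw hT _ b)]
  simp only [pwGrad_add, inner_add_left, add_mul]

theorem consInt_smul_left : 𝒯.consInt l (c • a) b = c * 𝒯.consInt l a b := by
  simp only [consInt, Finset.mul_sum]
  refine Finset.sum_congr rfl fun T hT => ?_
  simp only [pwGrad_smul, real_inner_smul_left, mul_assoc, integral_const_mul]
  ring

theorem consInt_add_right : 𝒯.consInt l b (a + a') = 𝒯.consInt l b a + 𝒯.consInt l b a' := by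
  simp only [consInt, ← mul_add, ← Finset.sum_add_distrib]
  congr 1
  refine Finset.sum_congr rfl fun T hT => ?_
  rw [← integral_add (𝒯.integrableOn_inner_mul_pw hT _ a) (𝒯.integrableOn_inner_mul_pw hT _ a')]
  simp only [pw_add, mul_add]

theorem consInt_smul_right : 𝒯.consInt l b (c • a) = c * 𝒯.consInt l b a := by
  simp only [consInt, Finset.mul_sum]
  refine Finset.sum_congr rfl fun T hT => ?_
  simp only [pw_smul, mul_left_comm _ c, integral_const_mul]

end Bilinear

end Triangulation

theorem nitsche_symm {d : ℕ} {G : Geometry d} (𝒯 : Triangulation G.Ω) (α : Fin 2 → ℝ) (lam : ℝ)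
    (u v : EuclideanSpace ℝ (Fin d) → ℝ) : nitsche 𝒯 α lam u v = nitsche 𝒯 α lam v u := by
  have h1 : ∀ i : Fin 2, ∫ x in G.sub i, (inner ℝ (gradient u x) (gradient v x) : ℝ) =
      ∫ x in G.sub i, inner ℝ (gradient v x) (gradient u x) := fun i => by
    simp only [real_inner_comm]
  have h2 : jumpForm 𝒯 u v = jumpForm 𝒯 v u := by
    simp only [jumpForm, mul_comm]
  simp only [nitsche, h1, h2]
  ring

/-- Cauchy–Schwarz on the at most n nonzero terms. It is used with the d + 1 vertices of an element,
both for gradients and for point values. -/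
theorem norm_sum_sq_le_of_support {ι F : Type*} [SeminormedAddCommGroup F] (J T : Finset ι)
    {n : ℕ} (hT : T.card ≤ n) (w : ι → F) (hw : ∀ p, p ∉ T → w p = 0) :
    ‖∑ p ∈ J, w p‖ ^ 2 ≤ n * ∑ p ∈ J, ‖w p‖ ^ 2 := by
  classical
  have h1 : ∑ p ∈ J, w p = ∑ p ∈ J ∩ T, w p := by
    refine (Finset.sum_subset Finset.inter_subset_left fun p hp hp' => hw p fun h => ?_).symm
    exact hp' (Finset.mem_inter.2 ⟨hp, h⟩)
  calc ‖∑ p ∈ J, w p‖ ^ 2 ≤ (∑ p ∈ J ∩ T, ‖w p‖) ^ 2 := by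
        rw [h1]
        exact pow_le_pow_left₀ (norm_nonneg _) (norm_sum_le _ _) 2
    _ ≤ (J ∩ T).card * ∑ p ∈ J ∩ T, ‖w p‖ ^ 2 := sq_sum_le_card_mul_sum_sq
    _ ≤ n * ∑ p ∈ J, ‖w p‖ ^ 2 := by
        refine mul_le_mul ?_ ?_ (Finset.sum_nonneg fun _ _ => sq_nonneg _) (Nat.cast_nonneg _)
        · exact_mod_cast (Finset.card_le_card Finset.inter_subset_right).trans hT
        · exact Finset.sum_le_sum_of_subset_of_nonneg Finset.inter_subset_left
            fun _ _ _ => sq_nonneg _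

/-! ### Stability of the splitting into basis functions, and the consistency bound. -/

namespace Triangulation

variable {d : ℕ} {G : Geometry d} (𝒯 : Triangulation G.Ω) {σ μ : ℝ} {l : Fin 2}
  {T : Finset (EuclideanSpace ℝ (Fin d))}

open Classical in
/-- The coefficients of the basis function of the vertex `p`. -/
def unitCoeff (p q : EuclideanSpace ℝ (Fin d)) : ℝ := if q = p then 1 else 0

theorem comb_unitCoeff {p : EuclideanSpace ℝ (Fin d)} (hp : p ∈ 𝒯.J l) :
    𝒯.comb l (unitCoeff p) = 𝒯.xhat p := by
  simp [comb, unitCoeff, hp]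

theorem pw_unitCoeff {p : EuclideanSpace ℝ (Fin d)} (hp : p ∈ 𝒯.J l)
    (x : EuclideanSpace ℝ (Fin d)) : 𝒯.pw l T (unitCoeff p) x = bary T p x := by
  simp [pw, unitCoeff, hp]

theorem pwGrad_unitCoeff {p : EuclideanSpace ℝ (Fin d)} (hp : p ∈ 𝒯.J l) :
    𝒯.pwGrad l T (unitCoeff p) = baryGrad T p := by
  simp [pwGrad, unitCoeff, hp]

theorem gradForm_self (a : EuclideanSpace ℝ (Fin d) → ℝ) : 𝒯.gradForm l a a =
    ∑ T ∈ 𝒯.elems, volume.real (simplex T ∩ G.sub l) * ‖𝒯.pwGrad l T a‖ ^ 2 := by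
  simp only [gradForm, real_inner_self_eq_norm_sq]

theorem gradForm_self_nonneg (a : EuclideanSpace ℝ (Fin d) → ℝ) : 0 ≤ 𝒯.gradForm l a a := by
  rw [gradForm_self]
  exact Finset.sum_nonneg fun T _ => mul_nonneg measureReal_nonneg (sq_nonneg _)

theorem jumpInt_self_nonneg (a : EuclideanSpace ℝ (Fin d) → ℝ) : 0 ≤ 𝒯.jumpInt l a a :=
  Finset.sum_nonneg fun _ _ => integral_nonneg fun _ => mul_self_nonneg _

/-- The square of the energy norm, in terms of coefficients. -/
def energy (lam : ℝ) (l : Fin 2) (a : EuclideanSpace ℝ (Fin d) → ℝ) : ℝ :=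
  𝒯.gradForm l a a + lam * (𝒯.h⁻¹ * 𝒯.jumpInt l a a)

theorem h_nonneg : 0 ≤ 𝒯.h := Real.iSup_nonneg fun _ => Metric.diam_nonneg

/-- The energy of a function is bounded by the sum of the energies of its components. -/
theorem energy_le_sum {lam : ℝ} (hlam : 0 < lam) (a : EuclideanSpace ℝ (Fin d) → ℝ) :
    𝒯.energy lam l a ≤ (d + 1 : ℕ) * ∑ p ∈ 𝒯.J l, a p ^ 2 * 𝒯.energy lam l (unitCoeff p) := by
  have h1 : 𝒯.gradForm l a a ≤
      (d + 1 : ℕ) * ∑ p ∈ 𝒯.J l, a p ^ 2 * 𝒯.gradForm l (unitCoeff p) (unitCoeff p) := by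
    calc 𝒯.gradForm l a a ≤ ∑ T ∈ 𝒯.elems, volume.real (simplex T ∩ G.sub l) *
          ((d + 1 : ℕ) * ∑ p ∈ 𝒯.J l, ‖a p • baryGrad T p‖ ^ 2) := by
          rw [gradForm_self]
          refine Finset.sum_le_sum fun T hT => mul_le_mul_of_nonneg_left ?_ measureReal_nonneg
          refine norm_sum_sq_le_of_support _ T (𝒯.card_eq T hT).le _ fun p hp => ?_
          rw [(𝒯.isBary hT).grad_eq_zero p hp, smul_zero]
      _ = (d + 1 : ℕ) * ∑ p ∈ 𝒯.J l, a p ^ 2 * 𝒯.gradForm l (unitCoeff p) (unitCoeff p) := by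
          simp only [gradForm_self, Finset.mul_sum]
          rw [Finset.sum_comm]
          refine Finset.sum_congr rfl fun p hp => Finset.sum_congr rfl fun T _ => ?_
          rw [𝒯.pwGrad_unitCoeff hp, norm_smul, mul_pow, Real.norm_eq_abs, sq_abs]
          ring
  have h2 : 𝒯.jumpInt l a a ≤
      (d + 1 : ℕ) * ∑ p ∈ 𝒯.J l, a p ^ 2 * 𝒯.jumpInt l (unitCoeff p) (unitCoeff p) := by
    have hint : ∀ T ∈ 𝒯.elems, ∀ p ∈ 𝒯.J l, IntegrableOn (fun x => bary T p x * bary T p x)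
        (G.Γ ∩ interior (simplex T)) (surf d) := by
      intro T hT p hp
      have := 𝒯.integrableOn_pw_mul_pw (l := l) hT (unitCoeff p) (unitCoeff p)
      simpa only [𝒯.pw_unitCoeff hp] using this
    calc 𝒯.jumpInt l a a ≤ ∑ T ∈ 𝒯.elems, ∫ x in G.Γ ∩ interior (simplex T),
          (d + 1 : ℕ) * ∑ p ∈ 𝒯.J l, a p ^ 2 * (bary T p x * bary T p x) ∂(surf d) := by
          refine Finset.sum_le_sum fun T hT => ?_
          refine integral_mono (𝒯.integrableOn_pw_mul_pw hT a a) ?_ fun x => ?_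
          · exact (integrable_finsetSum _ fun p hp => (hint T hT p hp).const_mul _).const_mul _
          · change 𝒯.pw l T a x * 𝒯.pw l T a x ≤ _
            rw [← pow_two, pw]
            have := norm_sum_sq_le_of_support (𝒯.J l) T (𝒯.card_eq T hT).le
              (fun p => a p * bary T p x) fun p hp => by
                rw [(𝒯.isBary hT).eq_zero p hp, mul_zero]
            simpa only [Real.norm_eq_abs, sq_abs, mul_pow, pow_two (bary T _ x)] using this
      _ = (d + 1 : ℕ) * ∑ p ∈ 𝒯.J l, a p ^ 2 * 𝒯.jumpInt l (unitCoeff p) (unitCoeff p) := by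
          have h3 : ∀ T ∈ 𝒯.elems, ∫ x in G.Γ ∩ interior (simplex T),
              (d + 1 : ℕ) * ∑ p ∈ 𝒯.J l, a p ^ 2 * (bary T p x * bary T p x) ∂(surf d) =
              ∑ p ∈ 𝒯.J l, (d + 1 : ℕ) * (a p ^ 2 *
                ∫ x in G.Γ ∩ interior (simplex T), bary T p x * bary T p x ∂(surf d)) := by
            intro T hT
            rw [integral_const_mul, integral_finsetSum _ fun p hp => (hint T hT p hp).const_mul _,
              Finset.mul_sum]
            simp only [integral_const_mul]
          rw [Finset.sum_congr rfl h3, Finset.sum_comm, Finset.mul_sum]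
          refine Finset.sum_congr rfl fun p hp => ?_
          rw [jumpInt, Finset.mul_sum, Finset.mul_sum]
          simp only [𝒯.pw_unitCoeff hp]
  have h3 : 𝒯.h⁻¹ * 𝒯.jumpInt l a a ≤ 𝒯.h⁻¹ * ((d + 1 : ℕ) *
      ∑ p ∈ 𝒯.J l, a p ^ 2 * 𝒯.jumpInt l (unitCoeff p) (unitCoeff p)) :=
    mul_le_mul_of_nonneg_left h2 (inv_nonneg.2 𝒯.h_nonneg)
  calc 𝒯.energy lam l a ≤ (d + 1 : ℕ) * (∑ p ∈ 𝒯.J l, a p ^ 2 *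
        𝒯.gradForm l (unitCoeff p) (unitCoeff p)) + lam * (𝒯.h⁻¹ * ((d + 1 : ℕ) *
          ∑ p ∈ 𝒯.J l, a p ^ 2 * 𝒯.jumpInt l (unitCoeff p) (unitCoeff p))) :=
        add_le_add h1 (mul_le_mul_of_nonneg_left h3 hlam.le)
    _ = (d + 1 : ℕ) * ∑ p ∈ 𝒯.J l, a p ^ 2 * 𝒯.energy lam l (unitCoeff p) := by
        simp only [energy, mul_add, Finset.sum_add_distrib, Finset.mul_sum]
        congr 1
        exact Finset.sum_congr rfl fun p _ => by ring

variable {𝒯}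

/-- The element has a vertex q in `G.sub l`, which is not in `𝒯.J l`. The affine extension is 0 at q
and `a p` at p, so the gradient and the distance from p to q control the coefficient. The size of
the cut piece plays no role. -/
theorem Admissible.abs_coeff_le (hA : 𝒯.Admissible σ μ) (hT : T ∈ 𝒯.elems)
    (hcut : (simplex T ∩ G.Γ).Nonempty) (a : EuclideanSpace ℝ (Fin d) → ℝ)
    {p : EuclideanSpace ℝ (Fin d)} (hp : p ∈ 𝒯.J l) (hpT : p ∈ T) :
    |a p| ≤ Metric.diam (simplex T) * ‖𝒯.pwGrad l T a‖ := by
  classical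
  obtain ⟨q, hqT, hq⟩ := hA.vertex_mem T hT hcut l
  have H := 𝒯.isBary hT
  have hval : ∀ q ∈ T, 𝒯.pw l T a q = ∑ p ∈ 𝒯.J l, if p = q then a p else 0 := by
    intro q hq
    refine Finset.sum_congr rfl fun p _ => ?_
    by_cases hpT : p ∈ T
    · rw [H.apply_vertex p hpT q hq]
      split_ifs <;> simp
    · have hne : p ≠ q := fun h => hpT (h ▸ hq)
      rw [H.eq_zero p hpT, if_neg hne, mul_zero]
  have h1 : 𝒯.pw l T a p = a p := by
    rw [hval p hpT, Finset.sum_ite_eq' (𝒯.J l) p a, if_pos hp]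
  have h2 : 𝒯.pw l T a q = 0 := by
    rw [hval q hqT, Finset.sum_ite_eq' (𝒯.J l) q a, if_neg]
    exact fun h => Set.disjoint_left.1 (G.disjoint_sub' l) hq (J_subset_sub h)
  have h3 := 𝒯.pw_sub (l := l) hT a p q
  rw [h1, h2, sub_zero] at h3
  rw [h3, mul_comm]
  refine (abs_real_inner_le_norm _ _).trans (mul_le_mul_of_nonneg_left ?_ (norm_nonneg _))
  rw [← dist_eq_norm]
  exact dist_le_diam_simplex (vertex_mem_simplex hpT) (vertex_mem_simplex hqT)

theorem cut_of_volume_ne_zero (hT : T ∈ 𝒯.elems) {p : EuclideanSpace ℝ (Fin d)} (hp : p ∈ 𝒯.J l)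
    (hpT : p ∈ T) (hv : volume.real (simplex T ∩ G.sub l) ≠ 0) : (simplex T ∩ G.Γ).Nonempty := by
  have hne : (simplex T ∩ G.sub l).Nonempty := by
    rw [Set.nonempty_iff_ne_empty]
    intro h
    rw [h] at hv
    simp at hv
  obtain ⟨x, hxT, hx⟩ := hne
  exact 𝒯.cut_of_mem hT hpT (J_subset_sub hp) hxT hx

theorem Admissible.jumpInt_unitCoeff (hA : 𝒯.Admissible σ μ) {p : EuclideanSpace ℝ (Fin d)}
    (hp : p ∈ 𝒯.J l) :
    IntegrableOn (fun x => 𝒯.hat p x ^ 2) G.Γ (surf d) ∧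
      𝒯.jumpInt l (unitCoeff p) (unitCoeff p) = ∫ x in G.Γ, 𝒯.hat p x ^ 2 ∂(surf d) := by
  have heq : ∀ T ∈ 𝒯.elems, EqOn (fun x => 𝒯.pw l T (unitCoeff p) x * 𝒯.pw l T (unitCoeff p) x)
      (fun x => 𝒯.hat p x ^ 2) (G.Γ ∩ interior (simplex T)) := by
    intro T hT x hx
    simp only [𝒯.pw_unitCoeff hp, 𝒯.hat_eq_bary hT (interior_subset hx.2), pow_two]
  have hint : ∀ T ∈ 𝒯.elems, IntegrableOn (fun x => 𝒯.hat p x ^ 2)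
      (G.Γ ∩ interior (simplex T)) (surf d) := fun T hT =>
    (𝒯.integrableOn_pw_mul_pw hT _ _).congr_fun (heq T hT) measurableSet_piece
  refine ⟨𝒯.integrableOn_of_interior G.Γ_subset hA.face_null hint, ?_⟩
  rw [jumpInt, 𝒯.setIntegral_eq_sum G.measurableSet_Γ G.Γ_subset hA.face_null hint]
  exact Finset.sum_congr rfl fun T hT => setIntegral_congr_fun measurableSet_piece (heq T hT)

open Classical in
/-- The jump part of the energy of a basis function is controlled by the volume of the part of its
support in `sub l`. -/
theorem exists_jumpInt_unitCoeff_le (hd : 0 < d) (G : Geometry d) (σ μ : ℝ) (l : Fin 2) :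
    ∃ C : ℝ, 0 < C ∧ ∀ 𝒯 : Triangulation G.Ω, 𝒯.Admissible σ μ → ∀ p ∈ 𝒯.J l,
      𝒯.jumpInt l (unitCoeff p) (unitCoeff p) ≤
        C * 𝒯.h⁻¹ * ∑ T ∈ 𝒯.elems with p ∈ T, volume.real (simplex T ∩ G.sub l) := by
  obtain ⟨C, s, hs, hC⟩ := G.exists_lintegral_le_volume l
  by_cases hneg : ¬ (0 < σ * μ ∧ 0 < Metric.diam G.Ω)
  · refine ⟨1, one_pos, fun 𝒯 hA p hp => absurd ⟨?_, ?_⟩ hneg⟩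
    · obtain ⟨T, hT, -, hcut⟩ := exists_cut_of_mem_J hp
      exact mul_pos (hA.σ_pos hd) (hA.μ_pos hd hT hcut)
    · exact (𝒯.h_pos hd).trans_le 𝒯.h_le_diam
  push Not at hneg
  obtain ⟨hK, hD⟩ := hneg
  set K := σ * μ with hKdef
  set D := Metric.diam G.Ω with hDdef
  -- Since h ≤ D and nodal values v satisfy 0 ≤ v ≤ 1, this c makes c h v² at most both the ray
  -- length s and the length v h / K over which v cannot decay to zero.
  set c := min (s / D) (1 / K) with hc
  have hcpos : 0 < c := lt_min (by positivity) (by positivity)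
  -- The 1 only ensures that the constant is positive.
  refine ⟨(C + 1) / c, by positivity, fun 𝒯 hA p hp => ?_⟩
  have hh := 𝒯.h_pos hd
  have hhD : 𝒯.h ≤ D := 𝒯.h_le_diam
  set S : Set (EuclideanSpace ℝ (Fin d)) :=
    ⋃ T ∈ 𝒯.elems.filter (p ∈ ·), simplex T ∩ G.sub l with hS
  have hSmeas : MeasurableSet S :=
    Finset.measurableSet_biUnion _ fun T _ =>
      measurableSet_simplex.inter (G.isOpen_sub l).measurableSet
  have hSfin : volume S < ⊤ := (measure_biUnion_lt_top (Finset.finite_toSet _) fun T _ =>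
    (measure_mono inter_subset_left).trans_lt volume_simplex_lt_top)
  obtain ⟨hint, hjump⟩ := hA.jumpInt_unitCoeff hp
  have hpos : ∀ y ∈ G.sub l, 0 < 𝒯.hat p y → y ∈ S := by
    intro y hy hpos
    by_contra hcon
    refine hpos.ne' (𝒯.hat_eq_zero fun T hT hpT hyT => hcon ?_)
    exact Set.mem_biUnion (Finset.mem_filter.2 ⟨hT, hpT⟩) ⟨hyT, hy⟩
  -- The trace estimate is applied to c h v²; the ray condition holds because the ray lies in `S` as
  -- long as the nodal function is positive on it.
  have hmain := hC S hSmeas (fun x => ENNReal.ofReal (c * 𝒯.h * 𝒯.hat p x ^ 2)) ?_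
  · rw [← ofReal_integral_eq_lintegral_ofReal (hint.const_mul _)
      (Eventually.of_forall fun x => by positivity), integral_const_mul, ← hjump] at hmain
    have h1 : c * 𝒯.h * 𝒯.jumpInt l (unitCoeff p) (unitCoeff p) ≤ C * volume.real S := by
      have h2 := ENNReal.toReal_mono (ENNReal.mul_lt_top ENNReal.coe_lt_top hSfin).ne hmain
      rwa [ENNReal.toReal_ofReal (mul_nonneg (by positivity) (𝒯.jumpInt_self_nonneg _)),
        ENNReal.toReal_mul, ENNReal.coe_toReal] at h2
    have h3 : volume.real S ≤ ∑ T ∈ 𝒯.elems with p ∈ T, volume.real (simplex T ∩ G.sub l) :=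
      measureReal_biUnion_finset_le _ _
    have h4 : c * 𝒯.h * 𝒯.jumpInt l (unitCoeff p) (unitCoeff p) ≤
        (C + 1) * ∑ T ∈ 𝒯.elems with p ∈ T, volume.real (simplex T ∩ G.sub l) :=
      h1.trans (mul_le_mul (by linarith) h3 measureReal_nonneg (by positivity))
    have h5 : (C + 1) / c * 𝒯.h⁻¹ * ∑ T ∈ 𝒯.elems with p ∈ T, volume.real (simplex T ∩ G.sub l) =
        ((C + 1) * ∑ T ∈ 𝒯.elems with p ∈ T, volume.real (simplex T ∩ G.sub l)) / (c * 𝒯.h) := by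
      field_simp
    rw [h5, le_div_iff₀ (by positivity)]
    linarith
  · intro x hx e he hsub
    set v := 𝒯.hat p x with hv
    have hv0 : 0 ≤ v := 𝒯.hat_nonneg p x
    have hv1 : v ≤ 1 := 𝒯.hat_le_one p x
    have hle : c * 𝒯.h * v ^ 2 ≤ min s (v * 𝒯.h / K) := by
      refine le_min ?_ ?_
      · calc c * 𝒯.h * v ^ 2 ≤ s / D * D * 1 := by
              refine mul_le_mul (mul_le_mul (min_le_left _ _) hhD hh.le (by positivity))
                (by nlinarith) (sq_nonneg _) (by positivity)
          _ = s := by field_simp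
      · calc c * 𝒯.h * v ^ 2 ≤ 1 / K * 𝒯.h * v :=
              mul_le_mul (mul_le_mul_of_nonneg_right (min_le_right _ _) hh.le) (by nlinarith)
                (sq_nonneg _) (by positivity)
          _ = v * 𝒯.h / K := by ring
    calc ENNReal.ofReal (c * 𝒯.h * v ^ 2) ≤ ENNReal.ofReal (min s (v * 𝒯.h / K) - 0) := by
          rw [sub_zero]
          exact ENNReal.ofReal_le_ofReal hle
      _ = volume (Ioo 0 (min s (v * 𝒯.h / K))) := Real.volume_Ioo.symm
      _ ≤ volume {t : ℝ | t ∈ Ioo 0 s ∧ x + t • e ∈ S} := by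
          refine measure_mono fun t ht => ?_
          have hts : t ∈ Ioo 0 s := ⟨ht.1, ht.2.trans_le (min_le_left _ _)⟩
          refine ⟨hts, hpos _ (hsub t hts) ?_⟩
          have h1 := hA.hat_ray hd (J_subset_sub hp) (G.Γ_subset hx) he hsub
            (div_nonneg hK.le hh.le) ⟨hts.1.le, hts.2⟩
          have h2 : K / 𝒯.h * t < v := by
            have h3 : t < v * 𝒯.h / K := ht.2.trans_le (min_le_right _ _)
            rw [lt_div_iff₀ hK] at h3
            rw [div_mul_eq_mul_div, div_lt_iff₀ hh]
            linarith
          linarith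

/-- The sum of the energies of the components of a function is bounded by its energy. -/
theorem exists_sum_energy_le (hd : 0 < d) (G : Geometry d) (σ μ : ℝ) (l : Fin 2) {lam : ℝ}
    (hlam : 0 < lam) :
    ∃ C : ℝ, 0 < C ∧ ∀ 𝒯 : Triangulation G.Ω, 𝒯.Admissible σ μ →
      ∀ a : EuclideanSpace ℝ (Fin d) → ℝ,
        ∑ p ∈ 𝒯.J l, a p ^ 2 * 𝒯.energy lam l (unitCoeff p) ≤ C * 𝒯.energy lam l a := by
  classical
  obtain ⟨C, hC, hjump⟩ := exists_jumpInt_unitCoeff_le hd G σ μ l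
  -- For each vertex of T, σ² comes from the gradient of the basis function and `lam * C` from its
  -- jump; d + 1 counts the vertices.
  refine ⟨(d + 1 : ℕ) * (σ ^ 2 + lam * C), by positivity, fun 𝒯 hA a => ?_⟩
  have hh := 𝒯.h_pos hd
  set M := σ ^ 2 + lam * C with hM
  have hMpos : 0 < M := by positivity
  -- The gradient part of the energy of u alone controls all components, including their jumps.
  have hgrad : 𝒯.gradForm l a a ≤ 𝒯.energy lam l a := by
    rw [energy]
    have := mul_nonneg hlam.le (mul_nonneg (inv_nonneg.2 hh.le) (𝒯.jumpInt_self_nonneg (l := l) a))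
    linarith
  have hkey : ∀ p ∈ 𝒯.J l, a p ^ 2 * 𝒯.energy lam l (unitCoeff p) ≤
      ∑ T ∈ 𝒯.elems, if p ∈ T then
        M * (volume.real (simplex T ∩ G.sub l) * ‖𝒯.pwGrad l T a‖ ^ 2) else 0 := by
    intro p hp
    have h1 : 𝒯.gradForm l (unitCoeff p) (unitCoeff p) =
        ∑ T ∈ 𝒯.elems with p ∈ T, volume.real (simplex T ∩ G.sub l) * ‖baryGrad T p‖ ^ 2 := by
      rw [gradForm_self, Finset.sum_filter]
      refine Finset.sum_congr rfl fun T hT => ?_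
      rw [𝒯.pwGrad_unitCoeff hp]
      split_ifs with hpT
      · rfl
      · rw [(𝒯.isBary hT).grad_eq_zero p hpT]
        simp
    have h2 : 𝒯.energy lam l (unitCoeff p) ≤ ∑ T ∈ 𝒯.elems with p ∈ T,
        volume.real (simplex T ∩ G.sub l) * (‖baryGrad T p‖ ^ 2 + lam * C * 𝒯.h⁻¹ ^ 2) := by
      rw [energy, h1]
      have h3 := mul_le_mul_of_nonneg_left (hjump 𝒯 hA p hp)
        (mul_nonneg hlam.le (inv_nonneg.2 hh.le))
      calc _ ≤ (∑ T ∈ 𝒯.elems with p ∈ T, volume.real (simplex T ∩ G.sub l) * ‖baryGrad T p‖ ^ 2) +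
            lam * 𝒯.h⁻¹ * (C * 𝒯.h⁻¹ *
              ∑ T ∈ 𝒯.elems with p ∈ T, volume.real (simplex T ∩ G.sub l)) := by
            rw [← mul_assoc lam]
            gcongr
        _ = _ := by
            simp only [mul_add, Finset.sum_add_distrib, Finset.mul_sum]
            congr 1
            exact Finset.sum_congr rfl fun T _ => by ring
    rw [← Finset.sum_filter]
    refine (mul_le_mul_of_nonneg_left h2 (sq_nonneg _)).trans ?_
    rw [Finset.mul_sum]
    refine Finset.sum_le_sum fun T hT => ?_
    obtain ⟨hT, hpT⟩ := Finset.mem_filter.1 hT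
    -- Elements without volume in `G.sub l` contribute nothing; any other element at p is cut, so
    -- the coefficient bound applies.
    by_cases hv : volume.real (simplex T ∩ G.sub l) = 0
    · simp [hv]
    have hvpos : 0 ≤ volume.real (simplex T ∩ G.sub l) := measureReal_nonneg
    have hcut := cut_of_volume_ne_zero hT hp hpT hv
    have hdiam := 𝒯.diam_pos hd hT
    have hap := hA.abs_coeff_le (l := l) hT hcut a hp hpT
    set δ := Metric.diam (simplex T)
    set g := ‖𝒯.pwGrad l T a‖
    have hg : 0 ≤ g := norm_nonneg _
    have hap2 : a p ^ 2 ≤ δ ^ 2 * g ^ 2 := by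
      rw [← sq_abs, ← mul_pow]
      exact pow_le_pow_left₀ (abs_nonneg _) hap 2
    have hbg : ‖baryGrad T p‖ ^ 2 ≤ σ ^ 2 / δ ^ 2 := by
      rw [← div_pow]
      exact pow_le_pow_left₀ (norm_nonneg _) (hA.norm_baryGrad_le hd hT p) 2
    have hdh : δ ^ 2 * 𝒯.h⁻¹ ^ 2 ≤ 1 := by
      rw [← mul_pow]
      refine pow_le_one₀ (by positivity) ?_
      rw [← div_eq_mul_inv]
      exact div_le_one_of_le₀ (𝒯.diam_le_h hT) hh.le
    calc a p ^ 2 * (volume.real (simplex T ∩ G.sub l) *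
          (‖baryGrad T p‖ ^ 2 + lam * C * 𝒯.h⁻¹ ^ 2))
        ≤ (δ ^ 2 * g ^ 2) * (volume.real (simplex T ∩ G.sub l) *
          (σ ^ 2 / δ ^ 2 + lam * C * 𝒯.h⁻¹ ^ 2)) := by gcongr
      _ = (σ ^ 2 + lam * C * (δ ^ 2 * 𝒯.h⁻¹ ^ 2)) *
          (volume.real (simplex T ∩ G.sub l) * g ^ 2) := by
          field_simp
      _ ≤ (σ ^ 2 + lam * C * 1) * (volume.real (simplex T ∩ G.sub l) * g ^ 2) := by gcongr
      _ = M * (volume.real (simplex T ∩ G.sub l) * g ^ 2) := by rw [mul_one]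
  calc ∑ p ∈ 𝒯.J l, a p ^ 2 * 𝒯.energy lam l (unitCoeff p)
      ≤ ∑ p ∈ 𝒯.J l, ∑ T ∈ 𝒯.elems, if p ∈ T then
        M * (volume.real (simplex T ∩ G.sub l) * ‖𝒯.pwGrad l T a‖ ^ 2) else 0 :=
        Finset.sum_le_sum hkey
    _ ≤ ∑ T ∈ 𝒯.elems, (d + 1 : ℕ) *
        (M * (volume.real (simplex T ∩ G.sub l) * ‖𝒯.pwGrad l T a‖ ^ 2)) := by
        rw [Finset.sum_comm]
        refine Finset.sum_le_sum fun T hT => ?_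
        rw [← Finset.sum_filter, Finset.sum_const, nsmul_eq_mul]
        refine mul_le_mul_of_nonneg_right ?_
          (mul_nonneg hMpos.le (mul_nonneg measureReal_nonneg (sq_nonneg _)))
        rw [← 𝒯.card_eq T hT]
        exact_mod_cast Finset.card_le_card fun q hq => (Finset.mem_filter.1 hq).2
    _ = (d + 1 : ℕ) * M * 𝒯.gradForm l a a := by
        rw [gradForm_self, Finset.mul_sum]
        exact Finset.sum_congr rfl fun T _ => by ring
    _ ≤ (d + 1 : ℕ) * M * 𝒯.energy lam l a := by gcongr

/-- The consistency term is controlled by the two parts of the energy. -/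
theorem exists_consInt_le (hd : 0 < d) (G : Geometry d) (σ μ : ℝ) :
    ∃ M : ℝ, 0 < M ∧ ∀ 𝒯 : Triangulation G.Ω, 𝒯.Admissible σ μ → ∀ l : Fin 2,
      ∀ a : EuclideanSpace ℝ (Fin d) → ℝ,
        2 * |𝒯.consInt l a a| ≤
          1 / 2 * 𝒯.gradForm l a a + 2 * M * (𝒯.h⁻¹ * 𝒯.jumpInt l a a) := by
  obtain ⟨C, hC⟩ := G.exists_surf_closedBall_le
  set ω := volume.real (Metric.closedBall (0 : EuclideanSpace ℝ (Fin d)) 1) with hω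
  have hωpos : 0 < ω :=
    ENNReal.toReal_pos (Metric.measure_closedBall_pos _ _ one_pos).ne' measure_closedBall_lt_top.ne
  -- C bounds the density of the interface, and |T| is at least ω (h / (σ μ))^d on a cut element.
  -- The absolute value and the 1 give positivity before any triangulation is at hand.
  set M := C * |σ * μ| ^ d / ω + 1 with hM
  have hMpos : 0 < M := by positivity
  refine ⟨M, hMpos, fun 𝒯 hA l a => ?_⟩
  have hh := 𝒯.h_pos hd
  have hT : ∀ T ∈ 𝒯.elems, 2 * |κ G l T * ∫ x in G.Γ ∩ interior (simplex T),
      inner ℝ (𝒯.pwGrad l T a) (G.n x) * 𝒯.pw l T a x ∂(surf d)| ≤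
      1 / 2 * (volume.real (simplex T ∩ G.sub l) * ‖𝒯.pwGrad l T a‖ ^ 2) +
        2 * M / 𝒯.h * ∫ x in G.Γ ∩ interior (simplex T), 𝒯.pw l T a x * 𝒯.pw l T a x ∂(surf d) := by
    intro T hT
    rcases (G.Γ ∩ interior (simplex T)).eq_empty_or_nonempty with hempty | ⟨x₀, hx₀, hx₀T⟩
    · rw [hempty]
      simp only [Measure.restrict_empty, integral_zero_measure, mul_zero, abs_zero, add_zero]
      exact mul_nonneg (by norm_num) (mul_nonneg measureReal_nonneg (sq_nonneg _))
    have hcut : (simplex T ∩ G.Γ).Nonempty := ⟨x₀, interior_subset hx₀T, hx₀⟩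
    have hσ := hA.σ_pos hd
    have hμ := hA.μ_pos hd hT hcut
    set g := 𝒯.pwGrad l T a
    set k := κ G l T with hk
    set v := volume.real (simplex T ∩ G.sub l) with hv
    have hvol : ω * (𝒯.h / (σ * μ)) ^ d ≤ volume.real (simplex T) := by
      obtain ⟨c, r, hr, hball, hσr⟩ := hA.shape_regular T hT
      have h1 : 𝒯.h / (σ * μ) ≤ r := by
        rw [div_le_iff₀ (by positivity)]
        have h2 := hA.quasi_uniform T hT hcut
        nlinarith
      calc ω * (𝒯.h / (σ * μ)) ^ d ≤ ω * r ^ d := by gcongr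
        _ = volume.real (Metric.closedBall c r) := by
            rw [Measure.addHaar_real_closedBall' volume c hr.le,
              finrank_euclideanSpace_fin, mul_comm]
        _ ≤ volume.real (simplex T) := measureReal_mono hball volume_simplex_lt_top.ne
    have hvolpos : 0 < volume.real (simplex T) := lt_of_lt_of_le (by positivity) hvol
    have hv0 : 0 ≤ v := measureReal_nonneg
    have hk0 : 0 ≤ k := div_nonneg hv0 measureReal_nonneg
    have hk1 : k ≤ 1 := div_le_one_of_le₀
      (measureReal_mono inter_subset_left volume_simplex_lt_top.ne) measureReal_nonneg
    have hsurf : (surf d).real (G.Γ ∩ interior (simplex T)) ≤ C * 𝒯.h ^ (d - 1) := by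
      have h1 : G.Γ ∩ interior (simplex T) ⊆ G.Γ ∩ Metric.closedBall x₀ 𝒯.h := by
        rintro y ⟨hy, hyT⟩
        exact ⟨hy, (dist_le_diam_simplex (interior_subset hyT) (interior_subset hx₀T)).trans
          (𝒯.diam_le_h hT)⟩
      have h2 := ENNReal.toReal_mono
        (ENNReal.mul_lt_top ENNReal.coe_lt_top ENNReal.ofReal_lt_top).ne
        ((measure_mono h1).trans (hC x₀ 𝒯.h hh.le))
      rwa [ENNReal.toReal_mul, ENNReal.coe_toReal, ENNReal.toReal_ofReal (by positivity)] at h2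
    -- Here the choice of weights matters: k² ≤ k, and the remaining factor k = |T_l| / |T| turns
    -- h^d, which is bounded by a multiple of |T|, into a multiple of |T_l|.
    have hbound : 𝒯.h * k ^ 2 * (surf d).real (G.Γ ∩ interior (simplex T)) ≤ M * v := by
      have hpow : 𝒯.h * 𝒯.h ^ (d - 1) = 𝒯.h ^ d := by
        rw [← pow_succ']
        congr 1
        omega
      have h1 : 𝒯.h ^ d ≤ (σ * μ) ^ d / ω * volume.real (simplex T) := by
        rw [div_pow, ← mul_div_assoc, div_le_iff₀ (by positivity)] at hvol
        rw [div_mul_eq_mul_div, le_div_iff₀ hωpos]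
        linarith
      have h2 : k * volume.real (simplex T) = v := by
        rw [hk, κ, hv]
        field_simp
      calc 𝒯.h * k ^ 2 * (surf d).real (G.Γ ∩ interior (simplex T))
          ≤ 𝒯.h * k * (C * 𝒯.h ^ (d - 1)) := by
            gcongr
            nlinarith
        _ = C * k * 𝒯.h ^ d := by
            rw [← hpow]
            ring
        _ ≤ C * k * ((σ * μ) ^ d / ω * volume.real (simplex T)) := by gcongr
        _ = C * |σ * μ| ^ d / ω * v := by
            rw [← h2, abs_of_pos (mul_pos hσ hμ)]
            ring
        _ ≤ M * v := by
            gcongr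
            linarith
    have hconst : IntegrableOn (fun _ : EuclideanSpace ℝ (Fin d) => 𝒯.h / (2 * M) * k ^ 2 * ‖g‖ ^ 2)
        (G.Γ ∩ interior (simplex T)) (surf d) := integrableOn_const surf_piece_lt_top.ne
    have hsq := (𝒯.integrableOn_pw_mul_pw (l := l) hT a a).const_mul (2 * M / 𝒯.h)
    have hineq := norm_integral_le_of_norm_le (μ := (surf d).restrict (G.Γ ∩ interior (simplex T)))
      (f := fun x => 2 * (k * (inner ℝ g (G.n x) * 𝒯.pw l T a x))) (hconst.add hsq) (by
        refine Eventually.of_forall fun x => ?_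
        simp only [Pi.add_apply]
        have h1 : |(inner ℝ g (G.n x) : ℝ)| ≤ ‖g‖ :=
          (abs_real_inner_le_norm _ _).trans
            (mul_le_of_le_one_right (norm_nonneg _) (G.norm_n_le x))
        -- Young's inequality with weight h / (2M) as an exact square; integrating the gradient term
        -- and using `hbound` leaves the factor 1/2.
        have h2 : 𝒯.h / (2 * M) * k ^ 2 * ‖g‖ ^ 2 + 2 * M / 𝒯.h * (𝒯.pw l T a x * 𝒯.pw l T a x) -
            2 * (k * (‖g‖ * |𝒯.pw l T a x|)) =
            𝒯.h / (2 * M) * (k * ‖g‖ - 2 * M / 𝒯.h * |𝒯.pw l T a x|) ^ 2 := by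
          rw [← abs_mul_abs_self (𝒯.pw l T a x)]
          field_simp
          ring
        have h3 : 0 ≤ 𝒯.h / (2 * M) * (k * ‖g‖ - 2 * M / 𝒯.h * |𝒯.pw l T a x|) ^ 2 := by positivity
        rw [Real.norm_eq_abs, abs_mul, abs_two, abs_mul, abs_of_nonneg hk0, abs_mul]
        have h4 : 2 * (k * (|(inner ℝ g (G.n x) : ℝ)| * |𝒯.pw l T a x|)) ≤
            2 * (k * (‖g‖ * |𝒯.pw l T a x|)) := by gcongr
        linarith)
    simp only [Pi.add_apply] at hineq
    rw [integral_const_mul, integral_const_mul, integral_add hconst hsq,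
      integral_const_mul (2 * M / 𝒯.h),
      setIntegral_const, smul_eq_mul, Real.norm_eq_abs, abs_mul, abs_two] at hineq
    refine hineq.trans (add_le_add ?_ le_rfl)
    calc (surf d).real (G.Γ ∩ interior (simplex T)) * (𝒯.h / (2 * M) * k ^ 2 * ‖g‖ ^ 2)
        = 𝒯.h * k ^ 2 * (surf d).real (G.Γ ∩ interior (simplex T)) * (‖g‖ ^ 2 / (2 * M)) := by ring
      _ ≤ M * v * (‖g‖ ^ 2 / (2 * M)) := by gcongr
      _ = 1 / 2 * (v * ‖g‖ ^ 2) := by field_simp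
  calc 2 * |𝒯.consInt l a a| ≤ ∑ T ∈ 𝒯.elems, 2 * |κ G l T * ∫ x in G.Γ ∩ interior (simplex T),
        inner ℝ (𝒯.pwGrad l T a) (G.n x) * 𝒯.pw l T a x ∂(surf d)| := by
        rw [consInt, abs_mul, abs_sgn, one_mul, ← Finset.mul_sum]
        gcongr
        exact Finset.abs_sum_le_sum_abs _ _
    _ ≤ _ := Finset.sum_le_sum hT
    _ = 1 / 2 * 𝒯.gradForm l a a + 2 * M * (𝒯.h⁻¹ * 𝒯.jumpInt l a a) := by
        rw [Finset.sum_add_distrib, ← Finset.mul_sum, ← Finset.mul_sum, gradForm_self, jumpInt]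
        ring

end Triangulation

/-- A positive definite bilinear form on a finite-dimensional space represents every bilinear form
by a unique operator. -/
theorem existsUnique_operator {V : Type*} [AddCommGroup V] [Module ℝ V] [FiniteDimensional ℝ V]
    (b n : V →ₗ[ℝ] V →ₗ[ℝ] ℝ) (hb : ∀ u, b u u = 0 → u = 0) :
    ∃! A : V →ₗ[ℝ] V, ∀ u v, b (A u) v = n u v := by
  have hinj : Function.Injective b := by
    rw [injective_iff_map_eq_zero]
    intro u hu
    exact hb u (by rw [hu, LinearMap.zero_apply])
  let f : V ≃ₗ[ℝ] (V →ₗ[ℝ] ℝ) :=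
    LinearMap.linearEquivOfInjective b hinj (Subspace.dual_finrank_eq (K := ℝ) (V := V)).symm
  have hf : ∀ u, f u = b u := fun u => rfl
  refine ⟨f.symm.toLinearMap ∘ₗ n, fun u v => ?_, fun A hA => ?_⟩
  · change b (f.symm (n u)) v = n u v
    rw [← hf, f.apply_symm_apply]
  · refine LinearMap.ext fun u => f.injective ?_
    change f (A u) = f (f.symm (n u))
    rw [f.apply_symm_apply]
    exact LinearMap.ext fun v => hA u v

/-! ### Existence and uniqueness of the Ritz and Jacobi operators; energy equivalence. -/

namespace Triangulation

variable {d : ℕ} {G : Geometry d} (𝒯 : Triangulation G.Ω) {σ μ : ℝ} {l : Fin 2}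
  {T : Finset (EuclideanSpace ℝ (Fin d))}

theorem comb_mem_W (a : EuclideanSpace ℝ (Fin d) → ℝ) : 𝒯.comb l a ∈ 𝒯.W l :=
  Submodule.sum_mem _ fun _ hp =>
    Submodule.smul_mem _ _ (Submodule.subset_span (mem_image_of_mem _ hp))

theorem exists_eq_comb {u : EuclideanSpace ℝ (Fin d) → ℝ} (hu : u ∈ 𝒯.W l) :
    ∃ a, u = 𝒯.comb l a := by
  induction hu using Submodule.span_induction with
  | mem u hu =>
    obtain ⟨p, hp, rfl⟩ := hu
    exact ⟨unitCoeff p, (𝒯.comb_unitCoeff hp).symm⟩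
  | zero => exact ⟨0, by simp [comb]⟩
  | add u v _ _ hu hv =>
    obtain ⟨a, rfl⟩ := hu
    obtain ⟨b, rfl⟩ := hv
    exact ⟨a + b, (𝒯.comb_add a b).symm⟩
  | smul c u _ hu =>
    obtain ⟨a, rfl⟩ := hu
    exact ⟨c • a, (𝒯.comb_smul a c).symm⟩

theorem W_le_XFEM (l : Fin 2) : 𝒯.W l ≤ 𝒯.XFEM := by
  fin_cases l
  · exact le_sup_right.trans le_sup_left
  · exact le_sup_right

instance finiteDimensional_W (l : Fin 2) : FiniteDimensional ℝ (𝒯.W l) :=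
  FiniteDimensional.span_of_finite ℝ ((𝒯.J l).finite_toSet.image _)

theorem abs_heaviside_sub_le (x p : EuclideanSpace ℝ (Fin d)) :
    |(|heaviside G x - heaviside G p|)| ≤ 1 := by
  rw [abs_abs, heaviside, heaviside]
  split_ifs <;> norm_num

theorem abs_xhat_le_one (p x : EuclideanSpace ℝ (Fin d)) : |𝒯.xhat p x| ≤ 1 := by
  rw [xhat, abs_mul, abs_of_nonneg (𝒯.hat_nonneg p x)]
  exact mul_le_one₀ (𝒯.hat_le_one p x) (abs_nonneg _) (abs_heaviside_sub_le x p)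

theorem aestronglyMeasurable_xhat (p : EuclideanSpace ℝ (Fin d)) :
    AEStronglyMeasurable (𝒯.xhat p) (volume.restrict G.Ω) := by
  have h1 : AEStronglyMeasurable (𝒯.xhat p)
      (volume.restrict (⋃ T : 𝒯.elems, simplex (T : Finset (EuclideanSpace ℝ (Fin d))))) := by
    rw [aestronglyMeasurable_iUnion_iff]
    rintro ⟨T, hT⟩
    have hH : Measurable (heaviside G) := by
      unfold heaviside
      exact Measurable.ite (G.isOpen_sub 1).measurableSet measurable_const measurable_const
    have h2 : Measurable fun x => bary T p x * |heaviside G x - heaviside G p| := by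
      have h3 : Measurable fun x => |heaviside G x - heaviside G p| :=
        (continuous_abs.measurable).comp (hH.sub_const _)
      exact ((𝒯.isBary hT).continuous p).measurable.mul h3
    refine h2.aestronglyMeasurable.congr ?_
    filter_upwards [ae_restrict_mem measurableSet_simplex] with x hx
    rw [xhat, 𝒯.hat_eq_bary hT hx]
  refine h1.mono_set fun x hx => ?_
  obtain ⟨T, hT, hxT⟩ := 𝒯.exists_mem_simplex hx
  exact mem_iUnion.2 ⟨⟨T, hT⟩, hxT⟩

theorem integrableOn_comb_mul_comb (a b : EuclideanSpace ℝ (Fin d) → ℝ) :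
    IntegrableOn (fun x => 𝒯.comb l a x * 𝒯.comb l b x) G.Ω := by
  have hmeas : ∀ a, AEStronglyMeasurable (𝒯.comb l a) (volume.restrict G.Ω) := fun a =>
    Finset.aestronglyMeasurable_sum _ fun p _ => (𝒯.aestronglyMeasurable_xhat p).const_smul (a p)
  have hbound : ∀ a x, |𝒯.comb l a x| ≤ ∑ p ∈ 𝒯.J l, |a p| := by
    intro a x
    rw [comb_apply]
    refine (Finset.abs_sum_le_sum_abs _ _).trans (Finset.sum_le_sum fun p _ => ?_)
    rw [abs_mul]
    exact mul_le_of_le_one_right (abs_nonneg _) (𝒯.abs_xhat_le_one p x)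
  have hfin : IsFiniteMeasure (volume.restrict G.Ω) :=
    ⟨by rw [Measure.restrict_apply_univ]; exact G.bounded_Ω.measure_lt_top⟩
  refine Integrable.of_bound ((hmeas a).mul (hmeas b))
    ((∑ p ∈ 𝒯.J l, |a p|) * ∑ p ∈ 𝒯.J l, |b p|) (Eventually.of_forall fun x => ?_)
  rw [Real.norm_eq_abs, abs_mul]
  exact mul_le_mul (hbound a x) (hbound b x) (abs_nonneg _)
    (Finset.sum_nonneg fun _ _ => abs_nonneg _)

/-- The `L²` scalar product on `W l`. -/
def l2Form (l : Fin 2) : 𝒯.W l →ₗ[ℝ] 𝒯.W l →ₗ[ℝ] ℝ := by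
  have hint : ∀ u v : 𝒯.W l, IntegrableOn (fun x =>
      (u : EuclideanSpace ℝ (Fin d) → ℝ) x * (v : EuclideanSpace ℝ (Fin d) → ℝ) x) G.Ω := by
    rintro ⟨u, hu⟩ ⟨v, hv⟩
    obtain ⟨a, rfl⟩ := 𝒯.exists_eq_comb hu
    obtain ⟨b, rfl⟩ := 𝒯.exists_eq_comb hv
    exact 𝒯.integrableOn_comb_mul_comb a b
  refine LinearMap.mk₂ ℝ (fun u v => l2 G u v) (fun u v w => ?_) (fun c u v => ?_)
    (fun u v w => ?_) (fun c u v => ?_)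
  · simp only [l2, Submodule.coe_add, Pi.add_apply, add_mul]
    exact integral_add (hint u w) (hint v w)
  · simp only [l2, Submodule.coe_smul, Pi.smul_apply, smul_eq_mul, mul_assoc]
    exact integral_const_mul _ _
  · simp only [l2, Submodule.coe_add, Pi.add_apply, mul_add]
    exact integral_add (hint u v) (hint u w)
  · simp only [l2, Submodule.coe_smul, Pi.smul_apply, smul_eq_mul, mul_left_comm _ c]
    exact integral_const_mul _ _

theorem l2Form_apply (u v : 𝒯.W l) : 𝒯.l2Form l u v = l2 G u v := rfl

variable {𝒯}

/-- Some cut element has p as a vertex, and its part in `G.sub l` contains a nonempty open set by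
`part_pos`. A null function has zero affine part there, hence zero gradient, and `abs_coeff_le`
kills the coefficient. -/
theorem Admissible.coeff_eq_zero_of_l2 (hA : 𝒯.Admissible σ μ)
    {a : EuclideanSpace ℝ (Fin d) → ℝ} (h : l2 G (𝒯.comb l a) (𝒯.comb l a) = 0)
    {p : EuclideanSpace ℝ (Fin d)} (hp : p ∈ 𝒯.J l) : a p = 0 := by
  obtain ⟨T, hT, hpT, hcut⟩ := exists_cut_of_mem_J hp
  have hae : ∀ᵐ x ∂(volume.restrict G.Ω), 𝒯.comb l a x * 𝒯.comb l a x = 0 :=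
    (setIntegral_eq_zero_iff_of_nonneg_ae (Eventually.of_forall fun x => mul_self_nonneg _)
      (𝒯.integrableOn_comb_mul_comb a a)).1 h
  set U := G.sub l ∩ interior (simplex T) with hU
  have hUopen : IsOpen U := (G.isOpen_sub l).inter isOpen_interior
  have hUne : U.Nonempty := by
    refine nonempty_of_measure_ne_zero (μ := volume) ?_
    rw [hU, ← measure_congr (inter_simplex_ae_eq
      (measure_mono_null inter_subset_right volume_frontier_simplex)), inter_comm]
    exact (hA.part_pos T hT hcut l).ne'
  have hae' : 𝒯.pw l T a =ᵐ[volume.restrict U] fun _ => (0 : ℝ) := by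
    filter_upwards [ae_restrict_of_ae_restrict_of_subset
      (inter_subset_left.trans (G.sub_subset l)) hae, ae_restrict_mem hUopen.measurableSet]
      with x hx hxU
    rw [← 𝒯.comb_eq_pw hT a (interior_subset hxU.2) hxU.1]
    exact mul_self_eq_zero.1 hx
  have heq : EqOn (𝒯.pw l T a) (fun _ => (0 : ℝ)) U :=
    Measure.eqOn_open_of_ae_eq hae' hUopen (𝒯.continuous_pw hT a).continuousOn continuousOn_const
  obtain ⟨x, hx⟩ := hUne
  have hgrad : 𝒯.pwGrad l T a = 0 := by
    refine (𝒯.hasGradientAt_pw hT a x).unique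
      ((hasGradientAt_const x (0 : ℝ)).congr_of_eventuallyEq ?_)
    filter_upwards [hUopen.mem_nhds hx] with y hy using heq hy
  have := hA.abs_coeff_le hT hcut a hp hpT
  rw [hgrad, norm_zero, mul_zero] at this
  exact abs_nonpos_iff.1 this

theorem Admissible.l2Form_posDef (hA : 𝒯.Admissible σ μ) (u : 𝒯.W l) (h : 𝒯.l2Form l u u = 0) :
    u = 0 := by
  obtain ⟨u, hu⟩ := u
  obtain ⟨a, rfl⟩ := 𝒯.exists_eq_comb hu
  rw [l2Form_apply] at h
  refine Subtype.ext ?_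
  change 𝒯.comb l a = 0
  exact Finset.sum_eq_zero fun p hp => by rw [hA.coeff_eq_zero_of_l2 h hp, zero_smul]

theorem Admissible.coeff_unique (hA : 𝒯.Admissible σ μ) {a b : EuclideanSpace ℝ (Fin d) → ℝ}
    (h : 𝒯.comb l a = 𝒯.comb l b) {p : EuclideanSpace ℝ (Fin d)} (hp : p ∈ 𝒯.J l) :
    a p = b p := by
  have h1 : 𝒯.comb l (a + (-1 : ℝ) • b) = 0 := by
    rw [comb_add, comb_smul, h]
    simp
  have h2 : (a + (-1 : ℝ) • b) p = 0 := hA.coeff_eq_zero_of_l2 (by rw [h1]; simp [l2]) hp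
  simp only [Pi.add_apply, Pi.smul_apply, smul_eq_mul] at h2
  linarith

theorem Admissible.nitsche_add (hA : 𝒯.Admissible σ μ) (α : Fin 2 → ℝ) (lam : ℝ)
    {u v w : EuclideanSpace ℝ (Fin d) → ℝ} (hu : u ∈ 𝒯.W l) (hv : v ∈ 𝒯.W l) (hw : w ∈ 𝒯.W l) :
    nitsche 𝒯 α lam (u + v) w = nitsche 𝒯 α lam u w + nitsche 𝒯 α lam v w := by
  obtain ⟨a, rfl⟩ := 𝒯.exists_eq_comb hu
  obtain ⟨b, rfl⟩ := 𝒯.exists_eq_comb hv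
  obtain ⟨c, rfl⟩ := 𝒯.exists_eq_comb hw
  rw [← comb_add, hA.nitsche_comb, hA.nitsche_comb, hA.nitsche_comb, gradForm_add, jumpInt_add,
    consInt_add_left, consInt_add_right]
  ring

theorem Admissible.nitsche_smul (hA : 𝒯.Admissible σ μ) (α : Fin 2 → ℝ) (lam c : ℝ)
    {u w : EuclideanSpace ℝ (Fin d) → ℝ} (hu : u ∈ 𝒯.W l) (hw : w ∈ 𝒯.W l) :
    nitsche 𝒯 α lam (c • u) w = c * nitsche 𝒯 α lam u w := by
  obtain ⟨a, rfl⟩ := 𝒯.exists_eq_comb hu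
  obtain ⟨b, rfl⟩ := 𝒯.exists_eq_comb hw
  rw [← comb_smul, hA.nitsche_comb, hA.nitsche_comb, gradForm_smul, jumpInt_smul,
    consInt_smul_left, consInt_smul_right]
  ring

theorem Admissible.existsUnique_isRitz (hA : 𝒯.Admissible σ μ) (α : Fin 2 → ℝ) (lam : ℝ)
    (l : Fin 2) : ∃! A : 𝒯.W l →ₗ[ℝ] 𝒯.W l, IsRitz 𝒯 α lam l A := by
  let n : 𝒯.W l →ₗ[ℝ] 𝒯.W l →ₗ[ℝ] ℝ := LinearMap.mk₂ ℝ (fun u v => nitsche 𝒯 α lam u v)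
    (fun u v w => hA.nitsche_add α lam u.2 v.2 w.2)
    (fun c u w => hA.nitsche_smul α lam c u.2 w.2)
    (fun u v w => by
      rw [nitsche_symm, nitsche_symm 𝒯 α lam u v, nitsche_symm 𝒯 α lam u w]
      exact hA.nitsche_add α lam v.2 w.2 u.2)
    (fun c u w => by
      rw [nitsche_symm, nitsche_symm 𝒯 α lam u w]
      exact hA.nitsche_smul α lam c w.2 u.2)
  exact existsUnique_operator (𝒯.l2Form l) n hA.l2Form_posDef

/-- The defining identity ranges over all coefficient representations, so it is consistent only
because coefficients on `𝒯.J l` are unique. Chosen coefficients then depend linearly on u at these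
indices. -/
theorem Admissible.existsUnique_isJacobi (hA : 𝒯.Admissible σ μ) (α : Fin 2 → ℝ) (lam : ℝ)
    (l : Fin 2) : ∃! B : 𝒯.W l →ₗ[ℝ] 𝒯.W l, IsJacobi 𝒯 α lam l B := by
  choose coeff hcoeff using fun u : 𝒯.W l => 𝒯.exists_eq_comb u.2
  have huniq : ∀ (u : 𝒯.W l) (a : EuclideanSpace ℝ (Fin d) → ℝ),
      (u : EuclideanSpace ℝ (Fin d) → ℝ) = 𝒯.comb l a → ∀ p ∈ 𝒯.J l, coeff u p = a p :=
    fun u a hu p hp => hA.coeff_unique ((hcoeff u).symm.trans hu) hp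
  have hadd : ∀ u v : 𝒯.W l, ∀ p ∈ 𝒯.J l, coeff (u + v) p = coeff u p + coeff v p :=
    fun u v => huniq (u + v) (coeff u + coeff v)
      (by rw [comb_add, ← hcoeff, ← hcoeff, Submodule.coe_add])
  have hsmul : ∀ (c : ℝ) (u : 𝒯.W l), ∀ p ∈ 𝒯.J l, coeff (c • u) p = c * coeff u p :=
    fun c u => huniq (c • u) (c • coeff u) (by rw [comb_smul, ← hcoeff, Submodule.coe_smul])
  let n : 𝒯.W l →ₗ[ℝ] 𝒯.W l →ₗ[ℝ] ℝ := LinearMap.mk₂ ℝ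
    (fun u v => ∑ p ∈ 𝒯.J l, coeff u p * coeff v p * nitsche 𝒯 α lam (𝒯.xhat p) (𝒯.xhat p))
    (fun u v w => by
      rw [← Finset.sum_add_distrib]
      exact Finset.sum_congr rfl fun p hp => by rw [hadd u v p hp]; ring)
    (fun c u w => by
      rw [Finset.smul_sum]
      exact Finset.sum_congr rfl fun p hp => by rw [hsmul c u p hp, smul_eq_mul]; ring)
    (fun u v w => by
      rw [← Finset.sum_add_distrib]
      exact Finset.sum_congr rfl fun p hp => by rw [hadd v w p hp]; ring)
    (fun c u w => by
      rw [Finset.smul_sum]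
      exact Finset.sum_congr rfl fun p hp => by rw [hsmul c w p hp, smul_eq_mul]; ring)
  have hiff : ∀ B : 𝒯.W l →ₗ[ℝ] 𝒯.W l,
      IsJacobi 𝒯 α lam l B ↔ ∀ u v, 𝒯.l2Form l (B u) v = n u v := by
    intro B
    constructor
    · exact fun h u v => h u v (coeff u) (coeff v) (hcoeff u) (hcoeff v)
    · intro h u v a b hu hv
      refine (h u v).trans (Finset.sum_congr rfl fun p hp => ?_)
      rw [huniq u a hu p hp, huniq v b hv p hp]
  simp only [hiff]
  exact existsUnique_operator (𝒯.l2Form l) n hA.l2Form_posDef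

/-- If the consistency term is controlled by the energy and the stabilization is strong enough,
the Nitsche form is equivalent to the energy. -/
theorem Admissible.nitsche_equiv_energy (hA : 𝒯.Admissible σ μ) {M : ℝ} (hM : 0 < M)
    {α : Fin 2 → ℝ} {lam : ℝ} (hα : 0 < α l) (hlam : 4 * M * α l < lam)
    {a : EuclideanSpace ℝ (Fin d) → ℝ}
    (hcons : 2 * |𝒯.consInt l a a| ≤
      1 / 2 * 𝒯.gradForm l a a + 2 * M * (𝒯.h⁻¹ * 𝒯.jumpInt l a a)) :
    min (α l / 2) (1 / 2) * 𝒯.energy lam l a ≤ nitsche 𝒯 α lam (𝒯.comb l a) (𝒯.comb l a) ∧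
      nitsche 𝒯 α lam (𝒯.comb l a) (𝒯.comb l a) ≤
        max (3 / 2 * α l) (3 / 2) * 𝒯.energy lam l a := by
  rw [hA.nitsche_comb, energy]
  have hg := 𝒯.gradForm_self_nonneg (l := l) a
  have hj := mul_nonneg (inv_nonneg.2 𝒯.h_nonneg) (𝒯.jumpInt_self_nonneg (l := l) a)
  set g := 𝒯.gradForm l a a
  set j := 𝒯.h⁻¹ * 𝒯.jumpInt l a a
  set s := 𝒯.consInt l a a
  have hlam0 : 0 < lam := lt_trans (by positivity) hlam
  have hc : |2 * (α l * s)| ≤ α l * (1 / 2 * g + 2 * M * j) := by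
    calc |2 * (α l * s)| = α l * (2 * |s|) := by
          rw [abs_mul, abs_mul, abs_two, abs_of_pos hα]
          ring
      _ ≤ _ := mul_le_mul_of_nonneg_left hcons hα.le
  have hc' := abs_le.1 hc
  -- The jump part of the consistency bound, 2 M α_l j, is at most half the stabilization, and its
  -- gradient part is half of α_l g. Half of each term survives below, and at most three halves
  -- appear above.
  have hlamj : 4 * M * α l * j ≤ lam * j := mul_le_mul_of_nonneg_right hlam.le hj
  have hlj : 0 ≤ lam * j := mul_nonneg hlam0.le hj
  constructor
  · have h1 : min (α l / 2) (1 / 2) * g ≤ α l / 2 * g :=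
      mul_le_mul_of_nonneg_right (min_le_left _ _) hg
    have h2 : min (α l / 2) (1 / 2) * (lam * j) ≤ 1 / 2 * (lam * j) :=
      mul_le_mul_of_nonneg_right (min_le_right _ _) hlj
    rw [mul_add]
    linarith [hc'.2]
  · have h1 : 3 / 2 * α l * g ≤ max (3 / 2 * α l) (3 / 2) * g :=
      mul_le_mul_of_nonneg_right (le_max_left _ _) hg
    have h2 : 3 / 2 * (lam * j) ≤ max (3 / 2 * α l) (3 / 2) * (lam * j) :=
      mul_le_mul_of_nonneg_right (le_max_right _ _) hlj
    rw [mul_add]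
    linarith [hc'.1]

end Triangulation

end NitscheXFEM

end

/-! ### The spectral bounds. -/

theorem lemma4p2 (d : ℕ) (hd : d = 2 ∨ d = 3) (G : NitscheXFEM.Geometry d) (σ μ : ℝ) :
    ∃ cLam : ℝ, 0 < cLam ∧
      ∀ (α : Fin 2 → ℝ) (lam : ℝ) (ℱ : Set (NitscheXFEM.Triangulation G.Ω)),
        (∀ i, 0 < α i) → 0 < lam → (∀ 𝒯 ∈ ℱ, 𝒯.Admissible σ μ) →
        (cLam * max (α 0) (α 1) < lam ∨ NitscheXFEM.UniformNormEquiv ℱ α lam) →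
        ∃ γ ρ : Fin 2 → ℝ, (∀ l, 0 < γ l ∧ 0 < ρ l) ∧
          ∀ 𝒯 ∈ ℱ, ∀ l : Fin 2,
            (∃! A : 𝒯.W l →ₗ[ℝ] 𝒯.W l, NitscheXFEM.IsRitz 𝒯 α lam l A) ∧
            (∃! B : 𝒯.W l →ₗ[ℝ] 𝒯.W l, NitscheXFEM.IsJacobi 𝒯 α lam l B) ∧
            ∀ A B : 𝒯.W l →ₗ[ℝ] 𝒯.W l,
              NitscheXFEM.IsRitz 𝒯 α lam l A → NitscheXFEM.IsJacobi 𝒯 α lam l B →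
              ∀ u : 𝒯.W l,
                γ l * NitscheXFEM.l2 G (B u) u ≤ NitscheXFEM.l2 G (A u) u ∧
                NitscheXFEM.l2 G (A u) u ≤ ρ l * NitscheXFEM.l2 G (B u) u := by
  have hd0 : 0 < d := by omega
  obtain ⟨M, hM, hcons⟩ := NitscheXFEM.Triangulation.exists_consInt_le hd0 G σ μ
  refine ⟨4 * M, by positivity, fun α lam ℱ hα hlam hadm hequiv => ?_⟩
  -- Both alternatives for λ are reduced to the same statement on each `W l`; the general hypothesis
  -- applies because `W l` lies in the XFEM space.
  have hnorm : ∃ c C : Fin 2 → ℝ, (∀ l, 0 < c l ∧ 0 < C l) ∧ ∀ 𝒯 ∈ ℱ, ∀ l a,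
      c l * 𝒯.energy lam l a ≤ NitscheXFEM.nitsche 𝒯 α lam (𝒯.comb l a) (𝒯.comb l a) ∧
      NitscheXFEM.nitsche 𝒯 α lam (𝒯.comb l a) (𝒯.comb l a) ≤ C l * 𝒯.energy lam l a := by
    rcases hequiv with hbig | ⟨c, C, hc, hC, h⟩
    · refine ⟨fun l => min (α l / 2) (1 / 2), fun l => max (3 / 2 * α l) (3 / 2), fun l => ?_,
        fun 𝒯 h𝒯 l a => ?_⟩
      · have := hα l
        exact ⟨lt_min (by positivity) (by norm_num), lt_max_of_lt_right (by norm_num)⟩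
      · refine (hadm 𝒯 h𝒯).nitsche_equiv_energy hM (hα l) (lt_of_le_of_lt ?_ hbig)
          (hcons 𝒯 (hadm 𝒯 h𝒯) l a)
        refine mul_le_mul_of_nonneg_left ?_ (by positivity)
        fin_cases l
        · exact le_max_left _ _
        · exact le_max_right _ _
    · refine ⟨fun _ => c, fun _ => C, fun _ => ⟨hc, hC⟩, fun 𝒯 h𝒯 l a => ?_⟩
      have := h 𝒯 h𝒯 _ (𝒯.W_le_XFEM l (𝒯.comb_mem_W a))
      rwa [(hadm 𝒯 h𝒯).energySq_comb] at this
  obtain ⟨c, C, hcC, hnorm⟩ := hnorm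
  choose K hK hsum using fun l =>
    NitscheXFEM.Triangulation.exists_sum_energy_le hd0 G σ μ l hlam
  -- The Jacobi form lies between c and C times the sum of component energies. That sum is at most K
  -- times the energy and at least 1/(d + 1) times it, and the energy is compared with the Ritz form
  -- through c and C again.
  refine ⟨fun l => c l / (K l * C l), fun l => C l * (d + 1 : ℕ) / c l, fun l => ?_,
    fun 𝒯 h𝒯 l => ⟨(hadm 𝒯 h𝒯).existsUnique_isRitz α lam l,
      (hadm 𝒯 h𝒯).existsUnique_isJacobi α lam l, fun A B hA hB u => ?_⟩⟩
  · have h1 := hcC l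
    have h2 := hK l
    exact ⟨div_pos h1.1 (mul_pos h2 h1.2), div_pos (mul_pos h1.2 (by positivity)) h1.1⟩
  obtain ⟨hc, hC⟩ := hcC l
  obtain ⟨a, ha⟩ := 𝒯.exists_eq_comb u.2
  have hAu : NitscheXFEM.l2 G (A u) u =
      NitscheXFEM.nitsche 𝒯 α lam (𝒯.comb l a) (𝒯.comb l a) := by
    rw [hA u u, ha]
  have hBu : NitscheXFEM.l2 G (B u) u = ∑ p ∈ 𝒯.J l,
      a p ^ 2 * NitscheXFEM.nitsche 𝒯 α lam (𝒯.xhat p) (𝒯.xhat p) := by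
    rw [hB u u a a ha ha]
    exact Finset.sum_congr rfl fun p _ => by rw [pow_two]
  have hup : NitscheXFEM.l2 G (B u) u ≤ C l * ∑ p ∈ 𝒯.J l,
      a p ^ 2 * 𝒯.energy lam l (NitscheXFEM.Triangulation.unitCoeff p) := by
    rw [hBu, Finset.mul_sum]
    refine Finset.sum_le_sum fun p hp => ?_
    -- The equivalence is applied to a single basis function, whose Nitsche energy is a diagonal
    -- entry of the Jacobi form.
    have := (hnorm 𝒯 h𝒯 l (NitscheXFEM.Triangulation.unitCoeff p)).2
    rw [𝒯.comb_unitCoeff hp] at this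
    calc _ ≤ a p ^ 2 * (C l * 𝒯.energy lam l (NitscheXFEM.Triangulation.unitCoeff p)) :=
          mul_le_mul_of_nonneg_left this (sq_nonneg _)
      _ = _ := by ring
  have hlow : c l * ∑ p ∈ 𝒯.J l,
      a p ^ 2 * 𝒯.energy lam l (NitscheXFEM.Triangulation.unitCoeff p) ≤
        NitscheXFEM.l2 G (B u) u := by
    rw [hBu, Finset.mul_sum]
    refine Finset.sum_le_sum fun p hp => ?_
    have := (hnorm 𝒯 h𝒯 l (NitscheXFEM.Triangulation.unitCoeff p)).1
    rw [𝒯.comb_unitCoeff hp] at this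
    calc _ = a p ^ 2 * (c l * 𝒯.energy lam l (NitscheXFEM.Triangulation.unitCoeff p)) := by ring
      _ ≤ _ := mul_le_mul_of_nonneg_left this (sq_nonneg _)
  obtain ⟨hn1, hn2⟩ := hnorm 𝒯 h𝒯 l a
  rw [hAu]
  constructor
  · rw [div_mul_eq_mul_div, div_le_iff₀ (mul_pos (hK l) hC)]
    calc c l * NitscheXFEM.l2 G (B u) u
        ≤ c l * (C l * (K l * 𝒯.energy lam l a)) := by
          refine mul_le_mul_of_nonneg_left (hup.trans ?_) hc.le
          exact mul_le_mul_of_nonneg_left (hsum l 𝒯 (hadm 𝒯 h𝒯) a) hC.le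
      _ = (c l * 𝒯.energy lam l a) * (K l * C l) := by ring
      _ ≤ _ := mul_le_mul_of_nonneg_right hn1 (mul_pos (hK l) hC).le
  · rw [div_mul_eq_mul_div, le_div_iff₀ hc]
    calc NitscheXFEM.nitsche 𝒯 α lam (𝒯.comb l a) (𝒯.comb l a) * c l
        ≤ (C l * ((d + 1 : ℕ) * ∑ p ∈ 𝒯.J l,
            a p ^ 2 * 𝒯.energy lam l (NitscheXFEM.Triangulation.unitCoeff p))) * c l := by
          refine mul_le_mul_of_nonneg_right (hn2.trans ?_) hc.le
          exact mul_le_mul_of_nonneg_left (𝒯.energy_le_sum hlam a) hC.le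
      _ = C l * (d + 1 : ℕ) * (c l * ∑ p ∈ 𝒯.J l,
            a p ^ 2 * 𝒯.energy lam l (NitscheXFEM.Triangulation.unitCoeff p)) := by ring
      _ ≤ _ := mul_le_mul_of_nonneg_left hlow (mul_nonneg hC.le (Nat.cast_nonneg _))
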